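/- **Setting.** Pure states need not be normalized, $|0\rangle,\dots,|d-1\rangle$ is the computational basis of $\mathbb C^d$, $|0-i\rangle=\frac1{\sqrt2}(|0\rangle-|i\rangle)$, $|0+1+\cdots+(a-1)\rangle=\frac1{\sqrt a}(|0\rangle+\cdots+|a-1\rangle)$, and $\mathbb C^{a}\subseteq\mathbb C^{a'}$ for $a\le a'$ (span of the first $a$ basis vectors). For $3\le a\le b$ let $\mathcal S(a,b)$ be the set of the following $2b-1$ product states in $\mathbb C^a\otimes\mathbb C^b$: - $|i\rangle|0-i\rangle$ for $1\le i\le a-1$; - $|0-i\rangle|i+1\rangle$ for $1\le i\le a-2$, and $|0-(a-1)\rangle|1\rangle$; - $|0-1\rangle|j\rangle$ for $a\le j\le b-1$; - $|0+1\rangle\bigl(|2\rangle+\sum_{t=1}^{b-a}\omega^{st}|t+a-1\rangle\bigr)$ for $1\le s\le b-a$, where $\omega=e^{2\pi\sqrt{-1}/(b-a+1)}$; - $|0+1+\cdots+(a-1)\rangle|0+1+\cdots+(b-1)\rangle$. A set of orthogonal multipartite states is *genuinely nonlocal* if for every bipartition of the parties into two nonempty groups the states cannot be perfectly distinguished (identified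 with probability one) by a protocol of local operations and classical communication between the two groups, consisting of finitely many rounds of local measurements with finitely many outcomes. It is *locally reducible* if, all parties being separated, some single party can perform a measurement $\{M_k\}$, $\sum_k M_k^\dagger M_k=I$, that is orthogonality-preserving (for each outcome the postmeasurement states are mutually orthogonal), nontrivial (not all $M_k^\dagger M_k$ are proportional to $I$), and eliminates states (each outcome that can occur rules out at least one state). A genuinely nonlocal, locally reducible set has *genuine nonlocality of type I*. **Theorem.** Let $n\ge3$ and $3\le d_1-1\le d_2\le\cdots\le d_n$. In $\bigotimes_{i=1}^n\mathbb C^{d_i}$, with parties $A_1,\dots,A_n$, consider the following blocks $G_1,\dots,G_{n-1}$ of product states; in each block all parties not mentioned are in the state $|0\rangle$. - $G_1$: $A_1,A_2$ are in the states $|x\rangle,|y\rangle$ with $|x\rangle|y\rangle\in\mathcal S(d_1-1,d_2)$, and $A_n$ is in $|1\rangle$. - $G_2$ (if $n\ge4$): $A_1$ is in $|1\rangle$, and $A_2,A_3$ are in $|x\rangle,|z\rangle$ with $|x\rangle|z\rangle\in\mathcal S(d_2,d_3)$. - $G_k$, $3\le k\le n-2$: $A_1$ is in $|0\rangle$, $A_k$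 is in $|1\rangle$, and $A_2,A_{k+1}$ are in $|x\rangle,|z\rangle$ with $|x\rangle|z\rangle\in\mathcal S(d_2,d_{k+1})$. - $G_{n-1}$: $A_1$ is in $|d_1-1\rangle$, $A_{n-1}$ is in $|1\rangle$ (this only if $n\ge4$), and $A_2,A_n$ are in $|x\rangle,|z\rangle$ with $|x\rangle|z\rangle\in\mathcal S(d_2,d_n)$. Then $G_1\cup\cdots\cup G_{n-1}$ consists of exactly $\sum_{i=2}^n(2d_i-1)$ nonzero, mutually orthogonal product states, and it has genuine nonlocality of type I. -/

import Mathlib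

namespace QNonlocal

/-! ### Bipartite LOCC protocols

A pure bipartite state with amplitudes indexed by `α` (Alice) and `β` (Bob) is a matrix
`ψ : Matrix α β ℂ`; the operator `M ⊗ N` acts on it as `M * ψ * Nᵀ`.  States are not normalized. -/

/-- A finite LOCC protocol for two parties with local spaces `ℂ^α` and `ℂ^β`, producing a guess
in `ι`.  In each round one of the parties performs a measurement with finitely many outcomes, given
by Kraus operators `M k` with `∑ k, (M k)† (M k) = 1` (the output space may depend on the outcome,
so ancillas may be appended and subsystems discarded), and announces the outcome; the rest of the
protocol may depend on it. -/
inductive LOCCProtocol (ι : Type) : Type → Type → Type 1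
  | guess {α β : Type} (i : ι) : LOCCProtocol ι α β
  | alice {α β : Type} [DecidableEq α] (m : ℕ) (r : Fin m → ℕ)
      (M : (k : Fin m) → Matrix (Fin (r k)) α ℂ)
      (complete : ∑ k, (M k).conjTranspose * M k = 1)
      (next : (k : Fin m) → LOCCProtocol ι (Fin (r k)) β) : LOCCProtocol ι α β
  | bob {α β : Type} [DecidableEq β] (m : ℕ) (r : Fin m → ℕ)
      (N : (k : Fin m) → Matrix (Fin (r k)) β ℂ)
      (complete : ∑ k, (N k).conjTranspose * N k = 1)
      (next : (k : Fin m) → LOCCProtocol ι α (Fin (r k))) : LOCCProtocol ι α β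

/-- The squared norm of a bipartite state. -/
noncomputable def normSq {α β : Type} [Fintype α] [Fintype β] (ψ : Matrix α β ℂ) : ℝ :=
  ∑ x, ∑ y, ‖ψ x y‖ ^ 2

open Classical in
/-- The probability (times `normSq ψ`) that the protocol, run on `ψ`, ends with the guess `i`. -/
noncomputable def LOCCProtocol.prob {ι : Type} : {α β : Type} → [Fintype α] → [Fintype β] →
    LOCCProtocol ι α β → Matrix α β ℂ → ι → ℝ
  | _, _, _, _, .guess j, ψ, i => if j = i then normSq ψ else 0
  | _, _, _, _, @LOCCProtocol.alice _ _ _ _ _ _ M _ next, ψ, i => ∑ k, (next k).prob (M k * ψ) i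
  | _, _, _, _, @LOCCProtocol.bob _ _ _ _ _ _ N _ next, ψ, i => ∑ k, (next k).prob (ψ * (N k).transpose) i

/-- The bipartite states `ψ i` can be perfectly distinguished under LOCC: some protocol, run on
any `ψ i`, guesses `i` with probability one. -/
def LOCCDistinguishable {ι α β : Type} [Fintype α] [Fintype β] (ψ : ι → Matrix α β ℂ) : Prop :=
  ∃ P : LOCCProtocol ι α β, ∀ i, P.prob (ψ i) i = normSq (ψ i)

/-! ### Multipartite states -/

/-- (Unnormalized) pure states of `⨂ i, ℂ^(d i)`, given by their amplitudes in the computational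
basis. -/
abbrev State {n : ℕ} (d : Fin n → ℕ) : Type := ((i : Fin n) → Fin (d i)) → ℂ

/-- The product state `⨂ i, v i`. -/
def productState {n : ℕ} {d : Fin n → ℕ} (v : (i : Fin n) → Fin (d i) → ℂ) : State d :=
  fun x => ∏ i, v i (x i)

/-- The states `ψ i` are mutually orthogonal. -/
def MutuallyOrthogonal {n : ℕ} {d : Fin n → ℕ} {ι : Type} (ψ : ι → State d) : Prop :=
  ∀ i j, i ≠ j → star (ψ i) ⬝ᵥ ψ j = 0

/-- The state `ψ` seen as a bipartite state with respect to the bipartition `S | Sᶜ`. -/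
def bipartite {n : ℕ} {d : Fin n → ℕ} (S : Finset (Fin n)) (ψ : State d) :
    Matrix ((i : {i // i ∈ S}) → Fin (d i)) ((i : {i // i ∉ S}) → Fin (d i)) ℂ :=
  Matrix.of fun x y => ψ fun i => if h : i ∈ S then x ⟨i, h⟩ else y ⟨i, h⟩

/-- Genuine nonlocality: LOCC-indistinguishability in every bipartition of the parties. -/
def GenuinelyNonlocal {n : ℕ} {d : Fin n → ℕ} {ι : Type} (ψ : ι → State d) : Prop :=
  ∀ S : Finset (Fin n), S.Nonempty → Sᶜ.Nonempty →
    ¬ LOCCDistinguishable fun i => bipartite S (ψ i)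

/-- The operator `M` on party `p`, tensored with the identity on the others, applied to `ψ`. -/
def applyLocal {n : ℕ} {d : Fin n → ℕ} (p : Fin n) (M : Matrix (Fin (d p)) (Fin (d p)) ℂ)
    (ψ : State d) : State d :=
  fun x => ∑ j, M (x p) j * ψ (Function.update x p j)

/-- Local reducibility, all parties being separated: a single party can perform a nontrivial
orthogonality-preserving measurement which eliminates states, i.e. after every outcome that can
occur at least one of the states is ruled out. -/
def LocallyReducible {n : ℕ} {d : Fin n → ℕ} {ι : Type} (ψ : ι → State d) : Prop :=
  ∃ (p : Fin n) (m : ℕ) (M : Fin m → Matrix (Fin (d p)) (Fin (d p)) ℂ),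
    ∑ k, (M k).conjTranspose * M k = 1 ∧
    (∀ k, MutuallyOrthogonal fun i => applyLocal p (M k) (ψ i)) ∧
    (∃ k, ∀ c : ℂ, (M k).conjTranspose * M k ≠ c • 1) ∧
    (∀ k, (∃ i, applyLocal p (M k) (ψ i) ≠ 0) → ∃ i, applyLocal p (M k) (ψ i) = 0)

/-- Genuine nonlocality of type I. -/
def GenuinelyNonlocalTypeI {n : ℕ} {d : Fin n → ℕ} {ι : Type} (ψ : ι → State d) : Prop :=
  GenuinelyNonlocal ψ ∧ LocallyReducible ψ

/-! ### The states

Vectors of `ℂ^a` are written as amplitude functions `ℕ → ℂ` supported on `{0, …, a - 1}`, so that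
`ℂ^a` sits in `ℂ^a'` for `a ≤ a'`. -/

/-- `|j⟩` -/
def ket (j : ℕ) : ℕ → ℂ := fun x => if x = j then 1 else 0

/-- `|0 - i⟩ = (|0⟩ - |i⟩) / √2` -/
noncomputable def ketMinus (i : ℕ) : ℕ → ℂ := ((√2 : ℝ) : ℂ)⁻¹ • (ket 0 - ket i)

/-- `|0 + 1 + ⋯ + (a - 1)⟩ = (|0⟩ + ⋯ + |a - 1⟩) / √a` -/
noncomputable def ketAll (a : ℕ) : ℕ → ℂ := ((√a : ℝ) : ℂ)⁻¹ • ∑ j ∈ Finset.range a, ket j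

/-- `|2⟩ + ∑_{t = 1}^{b - a} ω ^ (s t) |t + a - 1⟩` with `ω = exp (2 π i / (b - a + 1))` -/
noncomputable def ketFourier (a b s : ℕ) : ℕ → ℂ :=
  ket 2 + ∑ t ∈ Finset.Icc 1 (b - a),
    Complex.exp (2 * Real.pi * Complex.I / (b - a + 1 : ℕ)) ^ (s * t) • ket (t + a - 1)

/-- Labels of the `2 b - 1` product states in `ℂ^a ⊗ ℂ^b`, where `3 ≤ a ≤ b`. The
arguments are indices starting from `0`; they stand for `i + 1`, `i + 1`, `a + j` and `s + 1`. -/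
inductive PairLabel (a b : ℕ) : Type
  | first (i : Fin (a - 1))
  | second (i : Fin (a - 1))
  | third (j : Fin (b - a))
  | fourth (s : Fin (b - a))
  | last

/-- The first tensor factors of the product states in `ℂ^a ⊗ ℂ^b`. -/
noncomputable def pairLeft {a b : ℕ} : PairLabel a b → ℕ → ℂ
  | .first i => ket (i + 1)
  | .second i => ketMinus (i + 1)
  | .third _ => ketMinus 1
  | .fourth _ => ketAll 2
  | .last => ketAll a

/-- The second tensor factors of the product states in `ℂ^a ⊗ ℂ^b`. -/
noncomputable def pairRight {a b : ℕ} : PairLabel a b → ℕ → ℂ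
  | .first i => ketMinus (i + 1)
  | .second i => if i + 1 = a - 1 then ket 1 else ket (i + 2)
  | .third j => ket (a + j)
  | .fourth s => ketFourier a b (s + 1)
  | .last => ketAll b

/-- The dimension of party `A_{i+1}` (zero if there is no such party). -/
def dimAt {n : ℕ} (d : Fin n → ℕ) (i : ℕ) : ℕ := if h : i < n then d ⟨i, h⟩ else 0

/-- The dimension of the first factor of the bipartite set used in block `G_k`: it is `d_1 - 1`
for `k = 1` and `d_2` for `k ≥ 2`. The second factor has dimension `d_{k+1}`. -/
def blockDim {n : ℕ} (d : Fin n → ℕ) (k : ℕ) : ℕ := if k = 1 then dimAt d 0 - 1 else dimAt d 1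

/-- Labels of the states: a block `G_k` with `1 ≤ k ≤ n - 1` (`k = κ + 1`) and a state in it. -/
abbrev Label {n : ℕ} (d : Fin n → ℕ) : Type :=
  Σ κ : Fin (n - 1), PairLabel (blockDim d (κ + 1)) (dimAt d (κ + 1))

/-- The state of party `A_{i+1}` in a state of the block `G_k`, when `x` and `z` are the two factors
of the corresponding bipartite product state. -/
def blockFactor (n d₁ k : ℕ) (x z : ℕ → ℂ) (i : ℕ) : ℕ → ℂ :=
  if k = 1 then
    if i = 0 then x else if i = 1 then z else if i = n - 1 then ket 1 else ket 0
  else if k = n - 1 then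
    if i = 0 then ket (d₁ - 1) else if i = 1 then x else if i = n - 1 then z
    else if i = n - 2 then ket 1 else ket 0
  else if k = 2 then
    if i = 0 then ket 1 else if i = 1 then x else if i = 2 then z else ket 0
  else
    if i = 0 then ket 0 else if i = 1 then x else if i = k then z
    else if i = k - 1 then ket 1 else ket 0

/-- The states of `G_1 ∪ ⋯ ∪ G_{n-1}`. -/
noncomputable def blockState {n : ℕ} (d : Fin n → ℕ) (l : Label d) : State d :=
  productState fun i x =>
    blockFactor n (dimAt d 0) (l.1 + 1) (pairLeft l.2) (pairRight l.2) i x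

end QNonlocal

namespace QNonlocal

open Matrix

/-! ### Squared norms and inner products along an LOCC protocol -/

section Protocols

variable {ι α β : Type} [Fintype α] [Fintype β]

/-! Nonlocality comes from rigidity of each bipartite set `S(a,b)`: if `E` on one factor keeps the
states orthogonal, then `E` is scalar (`pair_rigid_left`, `pair_rigid_right`). Many pairs of states
overlap on the other factor, so orthogonality falls on `E` alone. Such pairs kill the off-diagonal
entries; comparison with the uniform state equates the diagonal ones, the Fourier states handling
the indices from `a` on.

In a perfect protocol the branch states stay orthogonal after every outcome
(`LOCCProtocol.trace_eq_zero`). Rigidity then makes every measurement a multiple of an isometry on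
the space carrying the set, and some outcome has a nonzero factor. Following such outcomes leads to
a leaf where all states are still nonzero, yet one guess must serve them all
(`not_distinguished_of_locallyRigid`).

Block `G_k` puts such a set on two parties and basis vectors on the rest. The pairs of parties used
form a star centred at `A_2`, which is connected, so every bipartition cuts some pair; across that
cut the block is an isometric copy of a rigid set (`blockState_genuinelyNonlocal`).

Reducibility comes from `A_1` testing for `|d_1-1⟩`. The last block has exactly this vector there
and all other blocks are orthogonal to it, so each outcome fixes or annihilates every state
(`blockState_locallyReducible`). Distinct blocks are orthogonal at a single suitable party;
orthogonality and nonvanishing then give the count. -/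

theorem normSq_eq_trace (ψ : Matrix α β ℂ) : (normSq ψ : ℂ) = (ψᴴ * ψ).trace := by
  simp only [normSq, Matrix.trace, Matrix.mul_apply, Matrix.diag_apply, conjTranspose_apply]
  rw [Finset.sum_comm]
  push_cast
  refine Finset.sum_congr rfl fun y _ => Finset.sum_congr rfl fun x _ => ?_
  rw [← Complex.conj_mul', Complex.star_def]

theorem normSq_nonneg (ψ : Matrix α β ℂ) : 0 ≤ normSq ψ :=
  Finset.sum_nonneg fun _ _ => Finset.sum_nonneg fun _ _ => by positivity

theorem eq_zero_of_normSq_eq_zero {ψ : Matrix α β ℂ} (h : normSq ψ = 0) : ψ = 0 := by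
  ext x y
  have h1 := (Finset.sum_eq_zero_iff_of_nonneg
    (fun x _ => Finset.sum_nonneg fun y _ => by positivity)).1 h x (Finset.mem_univ x)
  have h2 := (Finset.sum_eq_zero_iff_of_nonneg (fun y _ => by positivity)).1 h1 y
    (Finset.mem_univ y)
  simpa using h2

theorem sum_trace_alice [DecidableEq α] {m : ℕ} {r : Fin m → ℕ}
    {M : (k : Fin m) → Matrix (Fin (r k)) α ℂ}
    (hM : ∑ k, (M k).conjTranspose * M k = 1) (ψ φ : Matrix α β ℂ) :
    ∑ k, ((M k * ψ)ᴴ * (M k * φ)).trace = (ψᴴ * φ).trace := by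
  have : ∀ k, (M k * ψ)ᴴ * (M k * φ) = ψᴴ * ((M k)ᴴ * M k) * φ := fun k => by
    simp only [conjTranspose_mul, Matrix.mul_assoc]
  simp_rw [this]
  rw [← Matrix.trace_sum, ← Matrix.sum_mul, ← Matrix.mul_sum, hM, Matrix.mul_one]

theorem sum_trace_bob [DecidableEq β] {m : ℕ} {r : Fin m → ℕ}
    {N : (k : Fin m) → Matrix (Fin (r k)) β ℂ}
    (hN : ∑ k, (N k).conjTranspose * N k = 1) (ψ φ : Matrix α β ℂ) :
    ∑ k, ((ψ * (N k)ᵀ)ᴴ * (φ * (N k)ᵀ)).trace = (ψᴴ * φ).trace := by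
  have : ∀ k, ((ψ * (N k)ᵀ)ᴴ * (φ * (N k)ᵀ)).trace = (ψᴴ * φ * ((N k)ᴴ * N k)ᵀ).trace := fun k => by
    rw [conjTranspose_mul, Matrix.mul_assoc, Matrix.trace_mul_comm, transpose_mul]
    simp only [Matrix.mul_assoc]
    rfl
  simp_rw [this]
  rw [← Matrix.trace_sum, ← Finset.mul_sum, ← Matrix.transpose_sum, hN, transpose_one, Matrix.mul_one]

theorem sum_normSq_alice [DecidableEq α] {m : ℕ} {r : Fin m → ℕ}
    {M : (k : Fin m) → Matrix (Fin (r k)) α ℂ}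
    (hM : ∑ k, (M k).conjTranspose * M k = 1) (ψ : Matrix α β ℂ) :
    ∑ k, normSq (M k * ψ) = normSq ψ := by
  have := sum_trace_alice hM ψ ψ
  simp_rw [← normSq_eq_trace] at this
  exact_mod_cast this

theorem sum_normSq_bob [DecidableEq β] {m : ℕ} {r : Fin m → ℕ}
    {N : (k : Fin m) → Matrix (Fin (r k)) β ℂ}
    (hN : ∑ k, (N k).conjTranspose * N k = 1) (ψ : Matrix α β ℂ) :
    ∑ k, normSq (ψ * (N k)ᵀ) = normSq ψ := by
  have := sum_trace_bob hN ψ ψ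
  simp_rw [← normSq_eq_trace] at this
  exact_mod_cast this

theorem LOCCProtocol.prob_guess (j : ι) (ψ : Matrix α β ℂ) (i : ι) [Decidable (j = i)] :
    (LOCCProtocol.guess j : LOCCProtocol ι α β).prob ψ i = if j = i then normSq ψ else 0 := by
  simp only [LOCCProtocol.prob]
  congr

theorem LOCCProtocol.prob_alice [DecidableEq α] (m : ℕ) (r : Fin m → ℕ)
    (M : (k : Fin m) → Matrix (Fin (r k)) α ℂ)
    (hM : ∑ k, (M k).conjTranspose * M k = 1)
    (next : (k : Fin m) → LOCCProtocol ι (Fin (r k)) β) (ψ : Matrix α β ℂ) (i : ι) :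
    (LOCCProtocol.alice m r M hM next).prob ψ i = ∑ k, (next k).prob (M k * ψ) i := by
  simp only [LOCCProtocol.prob]

theorem LOCCProtocol.prob_bob [DecidableEq β] (m : ℕ) (r : Fin m → ℕ)
    (N : (k : Fin m) → Matrix (Fin (r k)) β ℂ)
    (hN : ∑ k, (N k).conjTranspose * N k = 1)
    (next : (k : Fin m) → LOCCProtocol ι α (Fin (r k))) (ψ : Matrix α β ℂ) (i : ι) :
    (LOCCProtocol.bob m r N hN next).prob ψ i = ∑ k, (next k).prob (ψ * (N k)ᵀ) i := by
  simp only [LOCCProtocol.prob]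

end Protocols

/-- Complete measurements preserve total squared norm, and a leaf contributes all of it or nothing.
The `Fintype` instances are quantified after `P` because the local spaces change along the
induction. -/
theorem LOCCProtocol.prob_le_normSq {ι α β : Type} (P : LOCCProtocol ι α β) :
    ∀ [Fintype α] [Fintype β] (ψ : Matrix α β ℂ) (i : ι), P.prob ψ i ≤ normSq ψ := by
  classical
  induction P with
  | guess j =>
    intro _ _ ψ i
    rw [LOCCProtocol.prob_guess]
    split_ifs
    exacts [le_rfl, normSq_nonneg ψ]
  | alice m r M hM next ih =>
    intro _ _ ψ i
    rw [LOCCProtocol.prob_alice]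
    exact (Finset.sum_le_sum fun k _ => ih k _ i).trans_eq (sum_normSq_alice (by convert hM) ψ)
  | bob m r M hM next ih =>
    intro _ _ ψ i
    rw [LOCCProtocol.prob_bob]
    exact (Finset.sum_le_sum fun k _ => ih k _ i).trans_eq (sum_normSq_bob (by convert hM) ψ)

/-- If a state is identified with certainty, this remains so after each outcome of a first
measurement of Alice. -/
theorem LOCCProtocol.prob_next_alice {ι α β : Type} [Fintype α] [Fintype β] [DecidableEq α] {m : ℕ}
    {r : Fin m → ℕ} {M : (k : Fin m) → Matrix (Fin (r k)) α ℂ}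
    {hM : ∑ k, (M k).conjTranspose * M k = 1}
    {next : (k : Fin m) → LOCCProtocol ι (Fin (r k)) β} {ψ : Matrix α β ℂ} {i : ι}
    (h : (LOCCProtocol.alice m r M hM next).prob ψ i = normSq ψ) (k : Fin m) :
    (next k).prob (M k * ψ) i = normSq (M k * ψ) := by
  rw [LOCCProtocol.prob_alice, ← sum_normSq_alice hM] at h
  -- Each branch is bounded by its own squared norm and the totals agree, so every bound is
  -- attained.
  exact (Finset.sum_eq_sum_iff_of_le fun k _ => (next k).prob_le_normSq _ i).1 h k
    (Finset.mem_univ k)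

/-- If a state is identified with certainty, this remains so after each outcome of a first
measurement of Bob. -/
theorem LOCCProtocol.prob_next_bob {ι α β : Type} [Fintype α] [Fintype β] [DecidableEq β] {m : ℕ}
    {r : Fin m → ℕ} {N : (k : Fin m) → Matrix (Fin (r k)) β ℂ}
    {hN : ∑ k, (N k).conjTranspose * N k = 1}
    {next : (k : Fin m) → LOCCProtocol ι α (Fin (r k))} {ψ : Matrix α β ℂ} {i : ι}
    (h : (LOCCProtocol.bob m r N hN next).prob ψ i = normSq ψ) (k : Fin m) :
    (next k).prob (ψ * (N k)ᵀ) i = normSq (ψ * (N k)ᵀ) := by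
  rw [LOCCProtocol.prob_bob, ← sum_normSq_bob hN] at h
  exact (Finset.sum_eq_sum_iff_of_le fun k _ => (next k).prob_le_normSq _ i).1 h k
    (Finset.mem_univ k)

/-- Perfectly distinguished states are orthogonal. -/
theorem LOCCProtocol.trace_eq_zero {ι α β : Type} (P : LOCCProtocol ι α β) :
    ∀ [Fintype α] [Fintype β] {ψ φ : Matrix α β ℂ} {i j : ι}, i ≠ j →
      P.prob ψ i = normSq ψ → P.prob φ j = normSq φ → (ψᴴ * φ).trace = 0 := by
  classical
  induction P with
  | guess g =>
    intro _ _ ψ φ i j hij hi hj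
    rw [LOCCProtocol.prob_guess] at hi hj
    -- A leaf announces a single guess, so at least one of the two states reaching it is zero.
    by_cases h : g = i
    · rw [if_neg (h ▸ hij)] at hj
      simp [eq_zero_of_normSq_eq_zero hj.symm]
    · rw [if_neg h] at hi
      simp [eq_zero_of_normSq_eq_zero hi.symm]
  | alice m r M hM next ih =>
    intro _ _ ψ φ i j hij hi hj
    rw [← sum_trace_alice (by convert hM)]
    exact Finset.sum_eq_zero fun k _ =>
      ih k hij (LOCCProtocol.prob_next_alice hi k) (LOCCProtocol.prob_next_alice hj k)
  | bob m r N hN next ih =>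
    intro _ _ ψ φ i j hij hi hj
    rw [← sum_trace_bob (by convert hN)]
    exact Finset.sum_eq_zero fun k _ =>
      ih k hij (LOCCProtocol.prob_next_bob hi k) (LOCCProtocol.prob_next_bob hj k)

/-! ### From local rigidity to LOCC indistinguishability -/

/-- Orthogonality-preserving measurements of the first party on the product states `x i ⊗ y i` are
trivial. -/
def LocallyRigid {κ α β : Type} [Fintype α] [Fintype β] [DecidableEq α]
    (x : κ → α → ℂ) (y : κ → β → ℂ) : Prop :=
  ∀ E : Matrix α α ℂ,
    (∀ i j, i ≠ j → (star (x i) ⬝ᵥ E *ᵥ x j) * (star (y i) ⬝ᵥ y j) = 0) → ∃ c : ℂ, E = c • 1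

theorem star_mulVec_dotProduct_mulVec {α α' : Type} [Fintype α] [Fintype α'] (A : Matrix α α' ℂ)
    (u v : α' → ℂ) : star (A *ᵥ u) ⬝ᵥ (A *ᵥ v) = star u ⬝ᵥ (Aᴴ * A) *ᵥ v := by
  rw [star_mulVec, ← Matrix.mulVec_mulVec, Matrix.dotProduct_mulVec, Matrix.dotProduct_mulVec,
    Matrix.dotProduct_mulVec]

theorem trace_vecMulVec_mul {α β : Type} [Fintype α] [Fintype β] (u u' : α → ℂ) (v v' : β → ℂ) :
    ((vecMulVec u v)ᴴ * vecMulVec u' v').trace = (star u ⬝ᵥ u') * (star v ⬝ᵥ v') := by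
  simp only [Matrix.trace, Matrix.mul_apply, Matrix.diag_apply, conjTranspose_apply, vecMulVec_apply,
    dotProduct, Finset.sum_mul_sum, Pi.star_apply, star_mul']
  rw [Finset.sum_comm]
  exact Finset.sum_congr rfl fun _ _ => Finset.sum_congr rfl fun _ _ => by ring

theorem vecMulVec_mul_transpose {α β γ : Type} [Fintype β] (u : α → ℂ) (v : β → ℂ)
    (N : Matrix γ β ℂ) : vecMulVec u v * Nᵀ = vecMulVec u (N *ᵥ v) := by
  rw [Matrix.vecMulVec_mul, Matrix.vecMul_transpose]

theorem mulVec_ne_zero_of_conjTranspose_mul {α α' : Type} [Fintype α] [Fintype α'] [DecidableEq α']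
    {A : Matrix α α' ℂ} {c : ℂ} (hc : c ≠ 0) (hA : Aᴴ * A = c • 1) {u : α' → ℂ} (hu : u ≠ 0) :
    A *ᵥ u ≠ 0 := by
  intro h
  have : (Aᴴ * A) *ᵥ u = 0 := by rw [← Matrix.mulVec_mulVec, h, Matrix.mulVec_zero]
  rw [hA, smul_mulVec, one_mulVec] at this
  exact (smul_ne_zero hc hu) this

/-- If every operator of a complete measurement acts on the range of a multiple of an isometry as a
multiple of an isometry, then one of them does so with a nonzero factor. -/
theorem exists_outcome_ne_zero {α α' : Type} [Fintype α] [Fintype α'] [DecidableEq α]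
    [DecidableEq α'] [Nonempty α'] {m : ℕ} {r : Fin m → ℕ}
    {M : (k : Fin m) → Matrix (Fin (r k)) α ℂ} (hM : ∑ k, (M k)ᴴ * M k = 1)
    {A : Matrix α α' ℂ} {c : ℂ} (hc : c ≠ 0) (hA : Aᴴ * A = c • 1)
    (h : ∀ k, ∃ e : ℂ, (M k * A)ᴴ * (M k * A) = e • 1) :
    ∃ k, ∃ e : ℂ, e ≠ 0 ∧ (M k * A)ᴴ * (M k * A) = e • 1 := by
  by_contra! hcon
  have h0 : ∀ k, (M k * A)ᴴ * (M k * A) = 0 := fun k => by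
    obtain ⟨e, he⟩ := h k
    by_cases h : e = 0
    · rw [he, h, zero_smul]
    · exact absurd he (hcon k e h)
  -- By completeness the outcome operators add up to `c • 1`, so they cannot all vanish.
  have h1 : ∑ k, (M k * A)ᴴ * (M k * A) = Aᴴ * A := by
    have : ∀ k, (M k * A)ᴴ * (M k * A) = Aᴴ * ((M k)ᴴ * M k) * A := fun k => by
      simp only [conjTranspose_mul, Matrix.mul_assoc]
    simp_rw [this]
    rw [← Matrix.sum_mul, ← Matrix.mul_sum, hM, Matrix.mul_one]
  rw [Finset.sum_eq_zero fun k _ => h0 k, hA] at h1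
  have h2 := congrFun (congrFun h1 (Classical.arbitrary α')) (Classical.arbitrary α')
  simp at h2
  exact hc h2.symm

/-- A set of product states on which both parties can only perform trivial orthogonality-preserving
measurements is not distinguished by any protocol, even after isometric embedding into larger
spaces and in the presence of further states. -/
theorem not_distinguished_of_locallyRigid {ι κ α₀ β₀ : Type} [Fintype α₀] [Fintype β₀]
    [DecidableEq α₀] [DecidableEq β₀] [Nontrivial κ] {x : κ → α₀ → ℂ} {y : κ → β₀ → ℂ}
    (hx : ∀ i, x i ≠ 0) (hy : ∀ i, y i ≠ 0) (hxy : LocallyRigid x y) (hyx : LocallyRigid y x)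
    {e : κ → ι} (he : e.Injective) {α β : Type} (P : LOCCProtocol ι α β) :
    ∀ [Fintype α] [Fintype β] (A : Matrix α α₀ ℂ) (B : Matrix β β₀ ℂ) (a b : ℂ),
      a ≠ 0 → b ≠ 0 → Aᴴ * A = a • 1 → Bᴴ * B = b • 1 →
      ¬ ∀ i, P.prob (vecMulVec (A *ᵥ x i) (B *ᵥ y i)) (e i) =
        normSq (vecMulVec (A *ᵥ x i) (B *ᵥ y i)) := by
  classical
  have hα : Nonempty α₀ := by
    obtain ⟨i, _⟩ := exists_pair_ne κ
    obtain ⟨u, _⟩ := Function.ne_iff.1 (hx i)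
    exact ⟨u⟩
  have hβ : Nonempty β₀ := by
    obtain ⟨i, _⟩ := exists_pair_ne κ
    obtain ⟨u, _⟩ := Function.ne_iff.1 (hy i)
    exact ⟨u⟩
  induction P with
  | guess g =>
    intro _ _ A B a b ha hb hA hB h
    -- Two labels cannot share the guess. The state missed has squared norm zero, although nonzero
    -- multiples of isometries keep both factors nonzero.
    obtain ⟨i, hi⟩ : ∃ i, g ≠ e i := by
      by_contra! hcon
      obtain ⟨i, j, hij⟩ := exists_pair_ne κ
      exact hij (he ((hcon i).symm.trans (hcon j)))
    have h1 := h i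
    rw [LOCCProtocol.prob_guess, if_neg hi] at h1
    obtain ⟨u, hu⟩ := Function.ne_iff.1 (mulVec_ne_zero_of_conjTranspose_mul ha hA (hx i))
    obtain ⟨v, hv⟩ := Function.ne_iff.1 (mulVec_ne_zero_of_conjTranspose_mul hb hB (hy i))
    have h2 := congrFun (congrFun (eq_zero_of_normSq_eq_zero h1.symm) u) v
    exact mul_ne_zero hu hv h2
  | alice m r M hM next ih =>
    intro _ _ A B a b ha hb hA hB h
    have hnext : ∀ k i, (next k).prob (vecMulVec ((M k * A) *ᵥ x i) (B *ᵥ y i)) (e i) =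
        normSq (vecMulVec ((M k * A) *ᵥ x i) (B *ᵥ y i)) := fun k i => by
      have := LOCCProtocol.prob_next_alice (h i) k
      rwa [Matrix.mul_vecMulVec, Matrix.mulVec_mulVec] at this
    -- Bob's overlap is only rescaled by `b ≠ 0`; dividing by it leaves the hypothesis of rigidity
    -- for `E = (M k * A)ᴴ * (M k * A)`.
    obtain ⟨k, f, hf, hk⟩ := exists_outcome_ne_zero (by convert hM) ha hA fun k => hxy _ fun i j hij => by
      have := (next k).trace_eq_zero (he.ne hij) (hnext k i) (hnext k j)
      rw [trace_vecMulVec_mul, star_mulVec_dotProduct_mulVec, star_mulVec_dotProduct_mulVec, hB,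
        smul_mulVec, one_mulVec, dotProduct_smul, smul_eq_mul, mul_left_comm] at this
      exact (mul_eq_zero.1 this).resolve_left hb
    exact ih k _ B f b hf hb hk hB (hnext k)
  | bob m r N hN next ih =>
    intro _ _ A B a b ha hb hA hB h
    have hnext : ∀ k i, (next k).prob (vecMulVec (A *ᵥ x i) ((N k * B) *ᵥ y i)) (e i) =
        normSq (vecMulVec (A *ᵥ x i) ((N k * B) *ᵥ y i)) := fun k i => by
      have := LOCCProtocol.prob_next_bob (h i) k
      rwa [vecMulVec_mul_transpose, Matrix.mulVec_mulVec] at this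
    obtain ⟨k, f, hf, hk⟩ := exists_outcome_ne_zero (by convert hN) hb hB fun k => hyx _ fun i j hij => by
      have := (next k).trace_eq_zero (he.ne hij) (hnext k i) (hnext k j)
      rw [trace_vecMulVec_mul, star_mulVec_dotProduct_mulVec, star_mulVec_dotProduct_mulVec, hA,
        smul_mulVec, one_mulVec, dotProduct_smul, smul_eq_mul, mul_assoc] at this
      rw [mul_comm]
      exact (mul_eq_zero.1 this).resolve_left ha
    exact ih k A _ a f ha hf hA hk (hnext k)

/-! ### Inner products of amplitude functions and finite Fourier analysis -/

section Amplitudes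

/-- The inner product of the restrictions of two amplitude functions to `{0, …, a - 1}`. -/
noncomputable def dotN (a : ℕ) (f g : ℕ → ℂ) : ℂ := ∑ u ∈ Finset.range a, star (f u) * g u

/-- A matrix with rows and columns in `{0, …, a - 1}` applied to an amplitude function. -/
noncomputable def applyN (a : ℕ) (e : ℕ → ℕ → ℂ) (g : ℕ → ℂ) : ℕ → ℂ :=
  fun u => ∑ v ∈ Finset.range a, e u v * g v

theorem dotN_star (a : ℕ) (f g : ℕ → ℂ) : star (dotN a f g) = dotN a g f := by
  simp [dotN, mul_comm]

theorem dotN_ket {a i : ℕ} (h : i < a) (g : ℕ → ℂ) : dotN a (ket i) g = g i := by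
  simp [dotN, ket, apply_ite, h]

theorem dotN_smul (a : ℕ) (c : ℂ) (f g : ℕ → ℂ) : dotN a (c • f) g = star c * dotN a f g := by
  simp [dotN, Finset.mul_sum, mul_assoc]

theorem dotN_sub (a : ℕ) (f f' g : ℕ → ℂ) : dotN a (f - f') g = dotN a f g - dotN a f' g := by
  simp [dotN, sub_mul, Finset.sum_sub_distrib]

theorem dotN_sum {γ : Type} (a : ℕ) (s : Finset γ) (f : γ → ℕ → ℂ) (g : ℕ → ℂ) :
    dotN a (∑ j ∈ s, f j) g = ∑ j ∈ s, dotN a (f j) g := by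
  simp only [dotN, Finset.sum_apply, star_sum, Finset.sum_mul]
  rw [Finset.sum_comm]

theorem dotN_ketMinus {a i : ℕ} (h : i < a) (g : ℕ → ℂ) :
    dotN a (ketMinus i) g = ((√2 : ℝ) : ℂ)⁻¹ * (g 0 - g i) := by
  rw [ketMinus, dotN_smul, dotN_sub, dotN_ket h, dotN_ket (by omega)]
  simp

theorem dotN_ketAll {a m : ℕ} (h : m ≤ a) (g : ℕ → ℂ) :
    dotN a (ketAll m) g = ((√m : ℝ) : ℂ)⁻¹ * ∑ j ∈ Finset.range m, g j := by
  rw [ketAll, dotN_smul, dotN_sum]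
  congr 1
  · simp
  · exact Finset.sum_congr rfl fun j hj => dotN_ket (by have := Finset.mem_range.1 hj; omega) _

/-- The root of unity `ω = exp (2 π i / (b - a + 1))`. -/
noncomputable def fourierRoot (a b : ℕ) : ℂ :=
  Complex.exp (2 * Real.pi * Complex.I / (b - a + 1 : ℕ))

theorem fourierRoot_isPrimitiveRoot (a b : ℕ) : IsPrimitiveRoot (fourierRoot a b) (b - a + 1) :=
  Complex.isPrimitiveRoot_exp _ (by omega)

theorem star_fourierRoot (a b : ℕ) : star (fourierRoot a b) = (fourierRoot a b)⁻¹ := by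
  rw [Complex.star_def, fourierRoot, ← Complex.exp_conj, ← Complex.exp_neg]
  congr 1
  simp [Complex.conj_ofNat, neg_div]

/-- The position of the `t`-th amplitude of `ketFourier`. -/
def fourierIndex (a t : ℕ) : ℕ := if t = 0 then 2 else t + a - 1

theorem fourierIndex_lt {a b t : ℕ} (ha : 3 ≤ a) (hab : a ≤ b) (ht : t < b - a + 1) :
    fourierIndex a t < b := by
  unfold fourierIndex
  split_ifs <;> omega

theorem fourierIndex_inj {a t t' : ℕ} (ha : 3 ≤ a) (h : fourierIndex a t = fourierIndex a t') :
    t = t' := by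
  unfold fourierIndex at h
  split_ifs at h <;> omega

/-- Counting `|2⟩` as the term `t = 0` turns the amplitudes into a full character modulo `b - a +
1`. -/
theorem ketFourier_eq (a b s : ℕ) :
    ketFourier a b s =
      ∑ t ∈ Finset.range (b - a + 1), fourierRoot a b ^ (s * t) • ket (fourierIndex a t) := by
  rw [Finset.sum_range_succ', ketFourier, add_comm]
  congr 1
  · rw [Finset.range_eq_Ico, Finset.sum_Ico_add' (fun t => fourierRoot a b ^ (s * t) •
      ket (fourierIndex a t)) 0 (b - a) 1]
    refine Finset.sum_congr (by ext; simp) fun t ht => ?_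
    have : t ≠ 0 := by have := Finset.mem_Icc.1 ht; omega
    rw [fourierIndex, if_neg this]
    rfl
  · simp [fourierIndex]

theorem dotN_ketFourier {a b : ℕ} (ha : 3 ≤ a) (hab : a ≤ b) (s : ℕ) (g : ℕ → ℂ) :
    dotN b (ketFourier a b s) g =
      ∑ t ∈ Finset.range (b - a + 1), (fourierRoot a b)⁻¹ ^ (s * t) * g (fourierIndex a t) := by
  rw [ketFourier_eq, dotN_sum]
  refine Finset.sum_congr rfl fun t ht => ?_
  rw [dotN_smul, dotN_ket (fourierIndex_lt ha hab (Finset.mem_range.1 ht)), star_pow,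
    star_fourierRoot]

theorem ketFourier_fourierIndex {a b : ℕ} (ha : 3 ≤ a) (s : ℕ) {t : ℕ} (ht : t < b - a + 1) :
    ketFourier a b s (fourierIndex a t) = fourierRoot a b ^ (s * t) := by
  rw [ketFourier_eq, Finset.sum_apply, Finset.sum_eq_single t]
  · simp [ket]
  · intro t' _ h
    have : fourierIndex a t ≠ fourierIndex a t' := fun h' => h (fourierIndex_inj ha h').symm
    simp [ket, this]
  · intro h
    exact absurd (Finset.mem_range.2 ht) h

theorem ketFourier_eq_zero {a b s u : ℕ} (h2 : u ≠ 2) (h : u < a) : ketFourier a b s u = 0 := by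
  rw [ketFourier_eq, Finset.sum_apply]
  refine Finset.sum_eq_zero fun t _ => ?_
  have : u ≠ fourierIndex a t := by
    unfold fourierIndex
    split_ifs <;> omega
  simp [ket, this]

theorem ketMinus_apply (i u : ℕ) :
    ketMinus i u = ((√2 : ℝ) : ℂ)⁻¹ * ((if u = 0 then 1 else 0) - if u = i then 1 else 0) := by
  simp [ketMinus, ket]

theorem ketAll_apply (m u : ℕ) :
    ketAll m u = if u < m then ((√m : ℝ) : ℂ)⁻¹ else 0 := by
  simp [ketAll, ket]

/-- Orthogonality of characters: the sum is geometric with ratio an `N`-th root of unity, equal to 1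
only when `s = s'`. -/
theorem sum_inv_pow_mul_pow {N : ℕ} {w : ℂ} (hw : IsPrimitiveRoot w N) (hN : 0 < N)
    {s s' : ℕ} (hs : s < N) (hs' : s' < N) :
    ∑ t ∈ Finset.range N, w⁻¹ ^ (s * t) * w ^ (s' * t) = if s = s' then (N : ℂ) else 0 := by
  have hw0 : w ≠ 0 := hw.ne_zero (by omega)
  have h1 : ∀ t, w⁻¹ ^ (s * t) * w ^ (s' * t) = (w⁻¹ ^ s * w ^ s') ^ t := fun t => by
    rw [mul_pow, ← pow_mul, ← pow_mul]
  simp_rw [h1]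
  split_ifs with h
  · subst h
    simp [inv_mul_cancel₀ (pow_ne_zero s hw0)]
  · have hz : w⁻¹ ^ s * w ^ s' ≠ 1 := by
      intro h'
      rw [inv_pow, inv_mul_eq_one₀ (pow_ne_zero _ hw0)] at h'
      exact h (hw.pow_inj hs hs' h')
    have := mul_neg_geom_sum (w⁻¹ ^ s * w ^ s') N
    have hN1 : (w⁻¹ ^ s * w ^ s') ^ N = 1 := by
      rw [mul_pow, ← pow_mul, ← pow_mul, mul_comm s, mul_comm s', pow_mul, pow_mul, inv_pow,
        hw.pow_eq_one]
      simp
    rw [hN1, sub_self] at this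
    exact (mul_eq_zero.1 this).resolve_left (sub_ne_zero.2 hz.symm)

/-- A function on `{0, …, N - 1}` whose nontrivial Fourier coefficients vanish is constant. -/
theorem eq_of_fourier_eq_zero {N : ℕ} {w : ℂ} (hw : IsPrimitiveRoot w N) (g : ℕ → ℂ)
    (h : ∀ s, 0 < s → s < N → ∑ t ∈ Finset.range N, w⁻¹ ^ (s * t) * g t = 0) {u : ℕ}
    (hu : u < N) : g u = (∑ t ∈ Finset.range N, g t) / N := by
  have hN : (N : ℂ) ≠ 0 := by
    have : N ≠ 0 := by omega
    exact_mod_cast this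
  rw [eq_div_iff hN]
  -- Fourier inversion at `u`: only frequency 0 survives, while exchanging the sums yields `N * g
  -- u`.
  have h1 : ∑ s ∈ Finset.range N, w ^ (u * s) * ∑ t ∈ Finset.range N, w⁻¹ ^ (s * t) * g t =
      ∑ t ∈ Finset.range N, g t := by
    rw [Finset.sum_eq_single 0]
    · simp
    · intro s hs h0
      rw [h s (by omega) (Finset.mem_range.1 hs), mul_zero]
    · intro h0
      simp at h0
      omega
  rw [← h1]
  simp_rw [Finset.mul_sum]
  rw [Finset.sum_comm]
  have h2 : ∀ t ∈ Finset.range N, ∑ s ∈ Finset.range N, w ^ (u * s) * (w⁻¹ ^ (s * t) * g t) =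
      if t = u then (N : ℂ) * g t else 0 := fun t ht => by
    have := sum_inv_pow_mul_pow hw (by omega) (Finset.mem_range.1 ht) hu
    have h3 : ∀ s, w ^ (u * s) * (w⁻¹ ^ (s * t) * g t) = (w⁻¹ ^ (t * s) * w ^ (u * s)) * g t :=
      fun s => by rw [mul_comm s t]; ring
    simp_rw [h3]
    rw [← Finset.sum_mul, this, ite_mul, zero_mul]
  rw [Finset.sum_congr rfl h2, Finset.sum_ite_eq' (Finset.range N) u, if_pos (Finset.mem_range.2 hu),
    mul_comm]

end Amplitudes

/-! ### Orthogonality and support of the bipartite set -/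

section Pair

theorem sqrt_inv_ne_zero {m : ℕ} (h : 0 < m) : ((√m : ℝ) : ℂ)⁻¹ ≠ 0 := by
  simp
  omega

theorem sqrt_two_inv_ne_zero : ((√2 : ℝ) : ℂ)⁻¹ ≠ 0 := by
  simp

variable {a b : ℕ}

theorem dotN_ketFourier_ketFourier (ha : 3 ≤ a) (hab : a ≤ b) {s s' : ℕ}
    (hs : s < b - a + 1) (hs' : s' < b - a + 1) :
    dotN b (ketFourier a b s) (ketFourier a b s') = if s = s' then ((b - a + 1 : ℕ) : ℂ) else 0 := by
  rw [dotN_ketFourier ha hab, ← sum_inv_pow_mul_pow (fourierRoot_isPrimitiveRoot a b)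
    (by omega) hs hs']
  exact Finset.sum_congr rfl fun t ht => by
    rw [ketFourier_fourierIndex ha s' (Finset.mem_range.1 ht)]

/-- On the Fourier positions the uniform vector is constant, a multiple of the character of
frequency 0. -/
theorem dotN_ketFourier_ketAll (ha : 3 ≤ a) (hab : a ≤ b) {s : ℕ} (hs0 : 0 < s)
    (hs : s < b - a + 1) : dotN b (ketFourier a b s) (ketAll b) = 0 := by
  rw [dotN_ketFourier ha hab]
  have := sum_inv_pow_mul_pow (fourierRoot_isPrimitiveRoot a b) (by omega) hs
    (show 0 < b - a + 1 by omega)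
  rw [if_neg (by omega)] at this
  have h2 : ∀ t ∈ Finset.range (b - a + 1),
      (fourierRoot a b)⁻¹ ^ (s * t) * ketAll b (fourierIndex a t) =
      (fourierRoot a b)⁻¹ ^ (s * t) * fourierRoot a b ^ (0 * t) * ((√b : ℝ) : ℂ)⁻¹ := fun t ht => by
    rw [ketAll_apply, if_pos (fourierIndex_lt ha hab (Finset.mem_range.1 ht))]
    simp
  rw [Finset.sum_congr rfl h2, ← Finset.sum_mul, this, zero_mul]

/-- An enumeration of the types of labels, used to reduce orthogonality to unordered pairs. -/
def PairLabel.rank : PairLabel a b → ℕ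
  | .first _ => 0
  | .second _ => 1
  | .third _ => 2
  | .fourth _ => 3
  | .last => 4

theorem pair_orthogonal_of_rank_le (ha : 3 ≤ a) (hab : a ≤ b) {l l' : PairLabel a b} (h : l ≠ l')
    (hr : l.rank ≤ l'.rank) :
    dotN a (pairLeft l) (pairLeft l') * dotN b (pairRight l) (pairRight l') = 0 := by
  rw [mul_eq_zero]
  rcases l with i | i | i | i | _ <;> rcases l' with j | j | j | j | _ <;>
    simp only [PairLabel.rank] at hr <;> try omega
  · left
    have : (i : ℕ) ≠ j := fun h' => h (by rw [Fin.ext h'])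
    rw [pairLeft, pairLeft, dotN_ket (by omega), ket, if_neg (by omega)]
  -- For equal indices the right ket avoids both 0 and `i + 1`; in the wrapped case this is `1 ≠ a -
  -- 1`, from `3 ≤ a`.
  · by_cases hij : i = j
    · right
      subst hij
      rw [pairRight, pairRight, dotN_ketMinus (by omega)]
      split_ifs with h1
      · simp [ket]; omega
      · simp [ket]
    · left
      have : (i : ℕ) ≠ j := fun h' => hij (Fin.ext h')
      rw [pairLeft, pairLeft, dotN_ket (by omega), ketMinus_apply, if_neg (by omega),
        if_neg (by omega)]
      simp
  · right
    rw [pairRight, pairRight, dotN_ketMinus (by omega)]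
    rw [ket, if_neg (by omega), ket, if_neg (by omega), sub_zero, mul_zero]
  · by_cases hi : (i : ℕ) = 0
    · right
      rw [pairRight, pairRight, dotN_ketMinus (by omega), ketFourier_eq_zero (by omega) (by omega),
        ketFourier_eq_zero (by omega) (by omega)]
      simp
    · left
      rw [pairLeft, pairLeft, dotN_ket (by omega), ketAll_apply, if_neg (by omega)]
  · right
    rw [pairRight, pairRight, dotN_ketMinus (by omega), ketAll_apply, ketAll_apply,
      if_pos (by omega), if_pos (by omega)]
    simp
  · right
    have : (i : ℕ) ≠ j := fun h' => h (by rw [Fin.ext h'])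
    rw [pairRight, pairRight]
    split_ifs <;> rw [dotN_ket (by omega), ket, if_neg (by omega)]
  · right
    rw [pairRight, pairRight]
    split_ifs <;> rw [dotN_ket (by omega), ket, if_neg (by omega)]
  -- For `i = 0` the right ket is `|2⟩`, which meets the Fourier vector, but `|0-1⟩` is orthogonal
  -- to `|0+1⟩`. Otherwise the right ket lies below `a` and differs from `|2⟩`.
  · by_cases hi : (i : ℕ) = 0
    · left
      rw [pairLeft, pairLeft, dotN_ketMinus (by omega), ketAll_apply, ketAll_apply,
        if_pos (by omega), if_pos (by omega)]
      simp
    · right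
      rw [pairRight, pairRight]
      split_ifs <;> rw [dotN_ket (by omega), ketFourier_eq_zero (by omega) (by omega)]
  · left
    rw [pairLeft, pairLeft, dotN_ketMinus (by omega), ketAll_apply, ketAll_apply,
      if_pos (by omega), if_pos (by omega)]
    simp
  · right
    have : (i : ℕ) ≠ j := fun h' => h (by rw [Fin.ext h'])
    rw [pairRight, pairRight, dotN_ket (by omega), ket, if_neg (by omega)]
  · left
    rw [pairLeft, pairLeft, dotN_ketMinus (by omega), ketAll_apply, ketAll_apply,
      if_pos (by omega), if_pos (by omega)]
    simp
  · left
    rw [pairLeft, pairLeft, dotN_ketMinus (by omega), ketAll_apply, ketAll_apply,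
      if_pos (by omega), if_pos (by omega)]
    simp
  · right
    have : (i : ℕ) ≠ j := fun h' => h (by rw [Fin.ext h'])
    rw [pairRight, pairRight, dotN_ketFourier_ketFourier ha hab (by omega) (by omega),
      if_neg (by omega)]
  · right
    rw [pairRight, pairRight, dotN_ketFourier_ketAll ha hab (by omega) (by omega)]
  · exact absurd rfl h

theorem pair_orthogonal (ha : 3 ≤ a) (hab : a ≤ b) {l l' : PairLabel a b} (h : l ≠ l') :
    dotN a (pairLeft l) (pairLeft l') * dotN b (pairRight l) (pairRight l') = 0 := by
  rcases le_total l.rank l'.rank with hr | hr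
  · exact pair_orthogonal_of_rank_le ha hab h hr
  · rw [← dotN_star a, ← dotN_star b, ← star_mul', pair_orthogonal_of_rank_le ha hab h.symm hr,
      star_zero]

theorem exists_pairLeft_ne_zero (ha : 3 ≤ a) (l : PairLabel a b) : ∃ u < a, pairLeft l u ≠ 0 := by
  rcases l with i | i | i | i | _
  · exact ⟨i + 1, by omega, by simp [pairLeft, ket]⟩
  · exact ⟨0, by omega, by simp [pairLeft, ketMinus_apply]⟩
  · exact ⟨0, by omega, by simp [pairLeft, ketMinus_apply]⟩
  · exact ⟨0, by omega, by simp [pairLeft, ketAll_apply]⟩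
  · exact ⟨0, by omega, by simp [pairLeft, ketAll_apply]; omega⟩

theorem exists_pairRight_ne_zero (ha : 3 ≤ a) (hab : a ≤ b) (l : PairLabel a b) :
    ∃ u < b, pairRight l u ≠ 0 := by
  rcases l with i | i | i | i | _
  · exact ⟨0, by omega, by simp [pairRight, ketMinus_apply]⟩
  · by_cases h : (i : ℕ) + 1 = a - 1
    · exact ⟨1, by omega, by simp [pairRight, h, ket]⟩
    · exact ⟨i + 2, by omega, by simp [pairRight, h, ket]⟩
  · exact ⟨a + i, by omega, by simp [pairRight, ket]⟩
  · refine ⟨2, by omega, ?_⟩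
    have := ketFourier_fourierIndex (b := b) ha (i + 1) (t := 0) (by omega)
    rw [fourierIndex, if_pos rfl] at this
    rw [pairRight, this]
    simp
  · exact ⟨0, by omega, by simp [pairRight, ketAll_apply]; omega⟩

theorem pairLeft_eq_zero (ha : 3 ≤ a) (l : PairLabel a b) {u : ℕ} (hu : a ≤ u) :
    pairLeft l u = 0 := by
  rcases l with i | i | i | i | _
  · simp [pairLeft, ket]; omega
  · rw [pairLeft, ketMinus_apply, if_neg (by omega), if_neg (by omega)]; simp
  · rw [pairLeft, ketMinus_apply, if_neg (by omega), if_neg (by omega)]; simp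
  · rw [pairLeft, ketAll_apply, if_neg (by omega)]
  · rw [pairLeft, ketAll_apply, if_neg (by omega)]

end Pair

/-! ### Rigidity of both factors of the bipartite set -/

section Rigidity

theorem applyN_ket {a j : ℕ} (h : j < a) (e : ℕ → ℕ → ℂ) (u : ℕ) :
    applyN a e (ket j) u = e u j := by
  simp [applyN, ket, h]

theorem applyN_ketMinus {a j : ℕ} (h : j < a) (e : ℕ → ℕ → ℂ) (u : ℕ) :
    applyN a e (ketMinus j) u = ((√2 : ℝ) : ℂ)⁻¹ * (e u 0 - e u j) := by
  rw [← applyN_ket h e, ← applyN_ket (show 0 < a by omega) e u]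
  simp only [applyN, ketMinus, Pi.smul_apply, Pi.sub_apply, smul_eq_mul, ← Finset.sum_sub_distrib,
    Finset.mul_sum]
  exact Finset.sum_congr rfl fun v _ => by ring

theorem applyN_ketAll {a u : ℕ} {e : ℕ → ℕ → ℂ}
    (he : ∀ v < a, u ≠ v → e u v = 0) (hu : u < a) :
    applyN a e (ketAll a) u = ((√a : ℝ) : ℂ)⁻¹ * e u u := by
  rw [applyN, Finset.sum_eq_single u]
  · rw [ketAll_apply, if_pos hu, mul_comm]
  · intro v hv h
    rw [he v (Finset.mem_range.1 hv) h.symm, zero_mul]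
  · intro h
    exact absurd (Finset.mem_range.2 hu) h

variable {a b : ℕ}

/-- Every nonzero basis vector of the second factor is the second factor of a state whose first
factor is a difference of basis vectors. -/
theorem exists_ketMinus_ket (ha : 3 ≤ a) {i : ℕ} (h0 : 0 < i) (hi : i < b) :
    ∃ m : Fin (a - 1), (m : ℕ) + 1 ≠ i ∧ ∃ l : PairLabel a b,
      (∀ k, l ≠ .first k) ∧ l ≠ .last ∧
      pairLeft l = ketMinus (m + 1) ∧ pairRight l = ket i := by
  by_cases h : i < a
  · by_cases h1 : i = 1
    -- `|1⟩` occurs in the wrapped state `|0-(a-1)⟩|1⟩`.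
    · refine ⟨⟨a - 2, by omega⟩, by simp; omega, .second ⟨a - 2, by omega⟩, by simp, by simp, rfl, ?_⟩
      rw [pairRight, if_pos (by simp; omega), h1]
    · refine ⟨⟨i - 2, by omega⟩, by simp; omega, .second ⟨i - 2, by omega⟩, by simp, by simp, rfl, ?_⟩
      rw [pairRight, if_neg (by simp; omega)]
      congr 1
      simp
      omega
  · refine ⟨⟨0, by omega⟩, by simp; omega, .third ⟨i - a, by omega⟩, by simp, by simp, rfl, ?_⟩
    rw [pairRight]
    congr 1
    simp
    omega

/-- The shared `|0⟩` component makes the overlap 1/2, or 1 when the indices agree. -/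
theorem dotN_ketMinus_ketMinus_ne_zero {i j : ℕ} (hi0 : 0 < i) (hi : i < a) (hj0 : 0 < j) :
    dotN a (ketMinus i) (ketMinus j) ≠ 0 := by
  rw [dotN_ketMinus hi, ketMinus_apply, ketMinus_apply, if_neg (show i ≠ 0 by omega),
    if_neg (show 0 ≠ j by omega)]
  refine mul_ne_zero sqrt_two_inv_ne_zero ?_
  rw [← mul_sub]
  refine mul_ne_zero sqrt_two_inv_ne_zero ?_
  by_cases h : i = j <;> norm_num [h]

theorem ketMinus_self_ne_zero {i : ℕ} (hi0 : 0 < i) : ketMinus i i ≠ 0 := by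
  rw [ketMinus_apply, if_neg (by omega), if_pos rfl]
  simp

theorem dotN_ketMinus_ket_ne_zero {i : ℕ} (hi0 : 0 < i) (hi : i < a) :
    dotN a (ketMinus i) (ket i) ≠ 0 := by
  rw [dotN_ketMinus hi, ket, if_neg (by omega), ket, if_pos rfl]
  simp

theorem pair_rigid_left (ha : 3 ≤ a) (hab : a ≤ b) (e : ℕ → ℕ → ℂ)
    (h : ∀ l l' : PairLabel a b, l ≠ l' →
      dotN a (pairLeft l) (applyN a e (pairLeft l')) *
        dotN b (pairRight l) (pairRight l') = 0) {i j : ℕ} (hi : i < a) (hj : j < a) :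
    e i j = if i = j then e 0 0 else 0 := by
  have hr := sqrt_two_inv_ne_zero
  have hoff : ∀ i j : Fin (a - 1), i ≠ j → e (i + 1) (j + 1) = 0 := by
    intro i j hij
    have := (mul_eq_zero.1 (h (.first i) (.first j) (by simpa using hij))).resolve_right
      (dotN_ketMinus_ketMinus_ne_zero (by omega) (by omega) (by omega))
    rwa [pairLeft, pairLeft, dotN_ket (by omega), applyN_ket (by omega)] at this
  -- Pairing `|i⟩|0-i⟩` with a state `|0-j⟩|i⟩`, `j ≠ i`, equates the entries `(i, 0)` and `(i, j)`;
  -- the latter vanishes by `hoff`. The row 0 is treated symmetrically.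
  have hcol : ∀ i : Fin (a - 1), e (i + 1) 0 = 0 := by
    intro i
    obtain ⟨j, hji, l, hl, -, hl1, hl2⟩ :=
      exists_ketMinus_ket (b := b) ha (show 0 < (i : ℕ) + 1 by omega) (by omega)
    have := (mul_eq_zero.1 (h (.first i) l (hl i).symm)).resolve_right
      (by rw [hl2]; exact dotN_ketMinus_ket_ne_zero (by omega) (by omega))
    rw [hl1, pairLeft, dotN_ket (by omega), applyN_ketMinus (by omega),
      hoff i j (fun h' => hji (by rw [h']))] at this
    simpa using this
  have hrow : ∀ i : Fin (a - 1), e 0 (i + 1) = 0 := by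
    intro i
    obtain ⟨j, hji, l, hl, -, hl1, hl2⟩ :=
      exists_ketMinus_ket (b := b) ha (show 0 < (i : ℕ) + 1 by omega) (by omega)
    have := (mul_eq_zero.1 (h l (.first i) (hl i))).resolve_right
      (by rw [hl2, dotN_ket (by omega)]; exact ketMinus_self_ne_zero (by omega))
    rw [hl1, pairLeft, dotN_ketMinus (by omega), applyN_ket (by omega), applyN_ket (by omega),
      hoff j i (fun h' => hji (by rw [h']))] at this
    simpa using this
  have hz : ∀ i < a, ∀ j < a, i ≠ j → e i j = 0 := by
    intro i hi j hj hij
    rcases Nat.eq_zero_or_pos i with rfl | h0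
    · simpa [show j - 1 + 1 = j by omega] using hrow ⟨j - 1, by omega⟩
    · rcases Nat.eq_zero_or_pos j with rfl | h0'
      · simpa [show i - 1 + 1 = i by omega] using hcol ⟨i - 1, by omega⟩
      · simpa [show i - 1 + 1 = i by omega, show j - 1 + 1 = j by omega] using
          hoff ⟨i - 1, by omega⟩ ⟨j - 1, by omega⟩ (by simp; omega)
  split_ifs with hij
  · subst hij
    rcases Nat.eq_zero_or_pos i with rfl | h0
    · rfl
    -- The uniform state overlaps every right ket, so its pairing with `|0-i⟩` on the left equates
    -- the diagonal entries at 0 and `i`.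
    have hright : ∀ j : Fin (a - 1), dotN b (pairRight (.second j : PairLabel a b)) (ketAll b) ≠ 0 := by
      intro j
      rw [pairRight]
      split_ifs <;>
      · rw [dotN_ket (by omega), ketAll_apply, if_pos (by omega)]
        exact sqrt_inv_ne_zero (by omega)
    have := (mul_eq_zero.1 (h (.second ⟨i - 1, by omega⟩) .last (by simp))).resolve_right (hright _)
    rw [pairLeft, pairLeft, dotN_ketMinus (by simp; omega), applyN_ketAll (hz _ (by omega)) (by omega),
      applyN_ketAll (hz _ (by simp; omega)) (by simp; omega), ← mul_sub] at this
    simp only [show i - 1 + 1 = i by omega] at this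
    have := (mul_eq_zero.1 ((mul_eq_zero.1 this).resolve_left hr)).resolve_left
      (sqrt_inv_ne_zero (by omega))
    exact (sub_eq_zero.1 this).symm
  · exact hz i hi j hj hij

theorem pair_rigid_right (ha : 3 ≤ a) (hab : a ≤ b) (e : ℕ → ℕ → ℂ)
    (h : ∀ l l' : PairLabel a b, l ≠ l' →
      dotN b (pairRight l) (applyN b e (pairRight l')) *
        dotN a (pairLeft l) (pairLeft l') = 0) {i j : ℕ} (hi : i < b) (hj : j < b) :
    e i j = if i = j then e 0 0 else 0 := by
  have hr := sqrt_two_inv_ne_zero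
  -- Every nonzero right ket is accompanied by some `|0-m⟩`, and two such left factors are never
  -- orthogonal.
  have hoff : ∀ i j : ℕ, 0 < i → 0 < j → i < b → j < b → i ≠ j → e i j = 0 := by
    intro i j hi0 hj0 hi hj hij
    obtain ⟨m, -, l, -, -, hl1, hl2⟩ := exists_ketMinus_ket ha hi0 hi
    obtain ⟨m', -, l', -, -, hl1', hl2'⟩ := exists_ketMinus_ket ha hj0 hj
    have hll : l ≠ l' := by
      rintro rfl
      rw [hl2] at hl2'
      have := congrFun hl2' i
      simp [ket, hij] at this
    have := (mul_eq_zero.1 (h l l' hll)).resolve_right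
      (by rw [hl1, hl1']; exact dotN_ketMinus_ketMinus_ne_zero (by omega) (by omega) (by omega))
    rwa [hl2, hl2', dotN_ket hi, applyN_ket hj] at this
  have hz : ∀ i < b, ∀ j < b, i ≠ j → e i j = 0 := by
    intro i hi j hj hij
    rcases Nat.eq_zero_or_pos i with rfl | h0
    · obtain ⟨m, hm, l, hl, -, hl1, hl2⟩ := exists_ketMinus_ket ha (show 0 < j by omega) hj
      have := (mul_eq_zero.1 (h (.first m) l (hl m).symm)).resolve_right (by
        rw [hl1, pairLeft, dotN_ket (by omega)]; exact ketMinus_self_ne_zero (by omega))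
      rw [hl2, pairRight, dotN_ketMinus (by omega), applyN_ket hj, applyN_ket hj,
        hoff _ j (by omega) (by omega) (by omega) hj hm] at this
      simpa using this
    · rcases Nat.eq_zero_or_pos j with rfl | h0'
      · obtain ⟨m, hm, l, hl, -, hl1, hl2⟩ := exists_ketMinus_ket ha h0 hi
        have := (mul_eq_zero.1 (h l (.first m) (hl m))).resolve_right (by
          rw [hl1, pairLeft]; exact dotN_ketMinus_ket_ne_zero (by omega) (by omega))
        rw [hl2, pairRight, dotN_ket hi, applyN_ketMinus (by omega),
          hoff i _ (by omega) (by omega) hi (by omega) hm.symm] at this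
        simpa using this
      · exact hoff i j h0 h0' hi hj hij
  have hlow : ∀ i < a, e i i = e 0 0 := by
    intro i hi
    rcases Nat.eq_zero_or_pos i with rfl | h0
    · rfl
    have := (mul_eq_zero.1 (h (.first ⟨i - 1, by omega⟩) .last (by simp))).resolve_right (by
      rw [pairLeft, pairLeft, dotN_ket (by simp; omega), ketAll_apply, if_pos (by simp; omega)]
      exact sqrt_inv_ne_zero (by omega))
    rw [pairRight, pairRight, dotN_ketMinus (by simp; omega),
      applyN_ketAll (hz _ (by omega)) (by omega),
      applyN_ketAll (hz _ (by simp; omega)) (by simp; omega), ← mul_sub] at this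
    simp only [show i - 1 + 1 = i by omega] at this
    have := (mul_eq_zero.1 ((mul_eq_zero.1 this).resolve_left hr)).resolve_left
      (sqrt_inv_ne_zero (by omega))
    exact (sub_eq_zero.1 this).symm
  -- Pairing a Fourier state with the uniform one reads off a nontrivial Fourier coefficient of the
  -- diagonal at the positions 2, `a`, …, `b - 1`.
  have hfour : ∀ s, 0 < s → s < b - a + 1 → ∑ t ∈ Finset.range (b - a + 1),
      (fourierRoot a b)⁻¹ ^ (s * t) * e (fourierIndex a t) (fourierIndex a t) = 0 := by
    intro s hs0 hs
    have := (mul_eq_zero.1 (h (.fourth ⟨s - 1, by omega⟩) .last (by simp))).resolve_right (by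
      rw [pairLeft, pairLeft, dotN_ketAll (by omega), Finset.sum_range_succ, Finset.sum_range_one,
        ketAll_apply, ketAll_apply, if_pos (by omega), if_pos (by omega), ← two_mul]
      exact mul_ne_zero (sqrt_inv_ne_zero (by omega))
        (mul_ne_zero two_ne_zero (sqrt_inv_ne_zero (by omega))))
    rw [pairRight, pairRight, dotN_ketFourier ha hab] at this
    simp only [show s - 1 + 1 = s by omega] at this
    rw [Finset.sum_congr rfl fun t ht => by
      have ht' := fourierIndex_lt ha hab (Finset.mem_range.1 ht)
      rw [applyN_ketAll (hz _ ht') ht', mul_left_comm], ← Finset.mul_sum] at this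
    exact (mul_eq_zero.1 this).resolve_left (sqrt_inv_ne_zero (by omega))
  split_ifs with hij
  · subst hij
    by_cases hia : i < a
    · exact hlow i hia
    · have hconst := fun {u : ℕ} (hu : u < b - a + 1) =>
        eq_of_fourier_eq_zero (fourierRoot_isPrimitiveRoot a b)
          (fun t => e (fourierIndex a t) (fourierIndex a t)) hfour hu
      -- Position 2 lies in both ranges and ties the indices from `a` on to those below `a`.
      have h1 := (hconst (u := i - a + 1) (by omega)).trans (hconst (u := 0) (by omega)).symm
      simp only [fourierIndex, if_true, if_neg (show i - a + 1 ≠ 0 by omega),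
        show i - a + 1 + a - 1 = i by omega] at h1
      rw [h1, hlow 2 (by omega)]
  · exact hz i hi j hj hij

/-- The entries of a matrix, extended by zero. -/
noncomputable def extendMatrix (E : Matrix (Fin a) (Fin a) ℂ) (u v : ℕ) : ℂ :=
  if h : u < a ∧ v < a then E ⟨u, h.1⟩ ⟨v, h.2⟩ else 0

theorem extendMatrix_apply (E : Matrix (Fin a) (Fin a) ℂ) (u v : Fin a) :
    extendMatrix E u v = E u v := by
  simp [extendMatrix]

theorem dotProduct_eq_dotN (f g : ℕ → ℂ) :
    star (fun u : Fin a => f u) ⬝ᵥ (fun u : Fin a => g u) = dotN a f g := by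
  simp [dotProduct, dotN, Finset.sum_range]

theorem mulVec_eq_applyN (E : Matrix (Fin a) (Fin a) ℂ) (g : ℕ → ℂ) :
    E *ᵥ (fun u : Fin a => g u) = fun u : Fin a => applyN a (extendMatrix E) g u := by
  ext u
  simp [mulVec, dotProduct, applyN, Finset.sum_range, extendMatrix_apply]

theorem eq_smul_one_of_extendMatrix {E : Matrix (Fin a) (Fin a) ℂ}
    (h : ∀ i < a, ∀ j < a, extendMatrix E i j = if i = j then extendMatrix E 0 0 else 0) :
    ∃ c : ℂ, E = c • 1 := by
  refine ⟨extendMatrix E 0 0, ?_⟩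
  ext u v
  rw [← extendMatrix_apply E u v, h u u.2 v v.2]
  simp [Matrix.one_apply, Fin.ext_iff]

theorem locallyRigid_pairLeft (ha : 3 ≤ a) (hab : a ≤ b) :
    LocallyRigid (fun (l : PairLabel a b) (u : Fin a) => pairLeft l u)
      (fun (l : PairLabel a b) (u : Fin b) => pairRight l u) := by
  intro E hE
  refine eq_smul_one_of_extendMatrix fun i hi j hj => pair_rigid_left ha hab _ (fun l l' hl => ?_) hi hj
  have := hE l l' hl
  rwa [mulVec_eq_applyN, dotProduct_eq_dotN (pairLeft l) (applyN _ _ _), dotProduct_eq_dotN] at this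

theorem locallyRigid_pairRight (ha : 3 ≤ a) (hab : a ≤ b) :
    LocallyRigid (fun (l : PairLabel a b) (u : Fin b) => pairRight l u)
      (fun (l : PairLabel a b) (u : Fin a) => pairLeft l u) := by
  intro E hE
  refine eq_smul_one_of_extendMatrix fun i hi j hj => pair_rigid_right ha hab _ (fun l l' hl => ?_) hi hj
  have := hE l l' hl
  rwa [mulVec_eq_applyN, dotProduct_eq_dotN (pairRight l) (applyN _ _ _), dotProduct_eq_dotN] at this

end Rigidity

/-! ### Isometric embedding of one party into a group of parties -/

section Embedding

variable {I : Type} [Fintype I] [DecidableEq I] {D : I → ℕ}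

theorem sum_star_prod_mul_prod (f g : I → ℕ → ℂ) :
    ∑ u : (i : I) → Fin (D i), star (∏ i, f i (u i)) * ∏ i, g i (u i) =
      ∏ i, dotN (D i) (f i) (g i) := by
  simp only [dotN, Finset.sum_range]
  rw [Finset.prod_univ_sum, Fintype.piFinset_univ]
  refine Finset.sum_congr rfl fun u _ => ?_
  rw [Finset.prod_mul_distrib, star_prod]

/-- The isometry that places a vector of `ℂ^a` at the party `p` and `|c i⟩` at the other
parties. -/
noncomputable def embedMatrix (D : I → ℕ) (a : ℕ) (p : I) (c : I → ℕ) :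
    Matrix ((i : I) → Fin (D i)) (Fin a) ℂ :=
  Matrix.of fun u x => ∏ i, (if i = p then ket x else ket (c i)) (u i)

theorem embedMatrix_mulVec {a : ℕ} (p : I) (c : I → ℕ) {X : ℕ → ℂ} (hX : ∀ u, a ≤ u → X u = 0) :
    embedMatrix D a p c *ᵥ (fun x : Fin a => X x) =
      fun u => ∏ i, (if i = p then X else ket (c i)) (u i) := by
  ext u
  have h : ∀ Y : ℕ → ℂ, ∏ i, (if i = p then Y else ket (c i)) (u i) =
      Y (u p) * ∏ i ∈ {p}ᶜ, ket (c i) (u i) := fun Y => by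
    rw [Fintype.prod_eq_mul_prod_compl p, if_pos rfl]
    congr 1
    exact Finset.prod_congr rfl fun i hi => by rw [if_neg (by simpa using hi)]
  simp only [embedMatrix, mulVec, dotProduct, Matrix.of_apply]
  rw [h X]
  simp_rw [h]
  have h2 : ∀ x : Fin a, ket x (u p) * (∏ i ∈ {p}ᶜ, ket (c i) (u i)) * X x =
      (ket x (u p) * X x) * ∏ i ∈ {p}ᶜ, ket (c i) (u i) := fun x => by ring
  simp_rw [h2]
  rw [← Finset.sum_mul, ← Finset.sum_range fun x => ket x (u p) * X x]
  congr 1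
  by_cases hu : (u p : ℕ) < a
  · simp [ket, hu]
  · simp [ket, hu, hX _ (not_lt.1 hu)]

/-- Inner products factor over the parties; each fixed basis vector contributes 1, so only the
overlap at `p` remains. -/
theorem embedMatrix_isometry {a : ℕ} {p : I} {c : I → ℕ} (hp : a ≤ D p)
    (hc : ∀ i, i ≠ p → c i < D i) : (embedMatrix D a p c)ᴴ * embedMatrix D a p c = 1 := by
  ext x y
  simp only [Matrix.mul_apply, conjTranspose_apply, embedMatrix, Matrix.of_apply]
  rw [sum_star_prod_mul_prod (fun i => if i = p then ket x else ket (c i))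
    (fun i => if i = p then ket y else ket (c i)), Fintype.prod_eq_mul_prod_compl p, if_pos rfl,
    if_pos rfl, dotN_ket (by omega), Finset.prod_eq_one, mul_one, ket, Matrix.one_apply]
  · simp [Fin.ext_iff]
  · intro i hi
    have hi : i ≠ p := by simpa using hi
    rw [if_neg hi, if_neg hi, dotN_ket (hc i hi), ket, if_pos rfl]

end Embedding

/-! ### Product states across a bipartition -/

section Multipartite

variable {n : ℕ} {d : Fin n → ℕ}

theorem bipartite_productState (S : Finset (Fin n)) (F : Fin n → ℕ → ℂ) :
    bipartite S (productState fun i (x : Fin (d i)) => F i x) =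
      vecMulVec (fun u => ∏ i : {i // i ∈ S}, F i (u i))
        (fun v => ∏ i : {i // i ∉ S}, F i (v i)) := by
  ext u v
  simp only [bipartite, productState, Matrix.of_apply, vecMulVec_apply]
  rw [← Fintype.prod_subtype_mul_prod_subtype (fun i => i ∈ S)]
  congr 1
  · exact Finset.prod_congr (by ext; simp) fun i _ => by rw [dif_pos i.2]
  · exact Finset.prod_congr (by ext; simp) fun i _ => by rw [dif_neg i.2]

theorem productState_dotProduct (F G : Fin n → ℕ → ℂ) :
    star (productState fun i (x : Fin (d i)) => F i x) ⬝ᵥ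
      (productState fun i (x : Fin (d i)) => G i x) = ∏ i, dotN (d i) (F i) (G i) := by
  rw [← sum_star_prod_mul_prod]
  rfl

/-- If a bipartition separates two parties, and some of the states carry a locally rigid set of
product states at these parties and fixed basis vectors elsewhere, then the states are not
distinguishable in this bipartition. -/
theorem not_distinguishable_of_locallyRigid {ι κ : Type} [Nontrivial κ] {ψ : ι → State d}
    {a b : ℕ} {X Z : κ → ℕ → ℂ} (hX : ∀ l u, a ≤ u → X l u = 0) (hZ : ∀ l u, b ≤ u → Z l u = 0)
    (hX0 : ∀ l, ∃ u < a, X l u ≠ 0) (hZ0 : ∀ l, ∃ u < b, Z l u ≠ 0)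
    (hXZ : LocallyRigid (fun l (u : Fin a) => X l u) (fun l (u : Fin b) => Z l u))
    (hZX : LocallyRigid (fun l (u : Fin b) => Z l u) (fun l (u : Fin a) => X l u))
    {e : κ → ι} (he : e.Injective) {p q : Fin n} (hp : a ≤ d p) (hq : b ≤ d q) {c : Fin n → ℕ}
    (hc : ∀ i, i ≠ p → i ≠ q → c i < d i)
    (hψ : ∀ l, ψ (e l) = productState fun i (x : Fin (d i)) =>
      (if i = p then X l else if i = q then Z l else ket (c i)) x)
    {S : Finset (Fin n)} (hpS : p ∈ S) (hqS : q ∉ S) :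
    ¬ LOCCDistinguishable fun i => bipartite S (ψ i) := by
  rintro ⟨P, hP⟩
  have hA := embedMatrix_isometry (D := fun i : {i // i ∈ S} => d i) (p := ⟨p, hpS⟩)
    (c := fun i => c i) hp fun i hi => hc i (fun h => hi (Subtype.ext h)) (fun h => hqS (h ▸ i.2))
  have hB := embedMatrix_isometry (D := fun i : {i // i ∉ S} => d i) (p := ⟨q, hqS⟩)
    (c := fun i => c i) hq fun i hi => hc i (fun h => i.2 (h ▸ hpS)) (fun h => hi (Subtype.ext h))
  refine not_distinguished_of_locallyRigid (fun l h => ?_) (fun l h => ?_) hXZ hZX he P _ _ 1 1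
    one_ne_zero one_ne_zero (hA.trans (one_smul ℂ _).symm) (hB.trans (one_smul ℂ _).symm)
    fun l => ?_
  · obtain ⟨u, hu, hu0⟩ := hX0 l
    exact hu0 (congrFun h ⟨u, hu⟩)
  · obtain ⟨u, hu, hu0⟩ := hZ0 l
    exact hu0 (congrFun h ⟨u, hu⟩)
  · have hstate : bipartite S (ψ (e l)) =
        vecMulVec (embedMatrix (fun i : {i // i ∈ S} => d i) a ⟨p, hpS⟩ (fun i => c i) *ᵥ
            (fun u : Fin a => X l u))
          (embedMatrix (fun i : {i // i ∉ S} => d i) b ⟨q, hqS⟩ (fun i => c i) *ᵥ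
            (fun u : Fin b => Z l u)) := by
      rw [hψ, bipartite_productState, embedMatrix_mulVec _ _ (hX l), embedMatrix_mulVec _ _ (hZ l)]
      congr 1
      · ext u
        refine Finset.prod_congr rfl fun i _ => ?_
        -- Inside `S` the party `q` never occurs, so only the choice between `X l` and the fixed
        -- kets is left.
        have : (i : Fin n) ≠ q := fun h => hqS (h ▸ i.2)
        simp only [this, if_false, Subtype.ext_iff]
      · ext u
        refine Finset.prod_congr rfl fun i _ => ?_
        have : (i : Fin n) ≠ p := fun h => i.2 (h ▸ hpS)
        simp only [this, if_false, Subtype.ext_iff]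
    rw [← hstate]
    exact hP (e l)

end Multipartite

/-! ### The blocks: orthogonality, count, nonlocality and reducibility -/

section Blocks

/-- The basis vectors at the parties of the block `G_k` not occupied by the bipartite set. -/
def fixedKet (n d₁ k i : ℕ) : ℕ :=
  if k = 1 then if i = n - 1 then 1 else 0
  else if k = n - 1 then if i = 0 then d₁ - 1 else if i = n - 2 then 1 else 0
  else if k = 2 then if i = 0 then 1 else 0
  else if i = k - 1 then 1 else 0

/-- The party of the first factor of the bipartite set in the block `G_k`. -/
def leftParty (k : ℕ) : ℕ := if k = 1 then 0 else 1

/-- One uniform shape for the four kinds of block: with parties numbered from 0, the pair sits at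
`leftParty k` and `k`. The star of pairs is visible in this form. -/
theorem blockFactor_eq {n k : ℕ} (hn : 3 ≤ n) (hk0 : 0 < k) (hk : k < n) (d₁ : ℕ)
    (x z : ℕ → ℂ) (i : ℕ) : blockFactor n d₁ k x z i =
      if i = leftParty k then x else if i = k then z else ket (fixedKet n d₁ k i) := by
  unfold blockFactor leftParty fixedKet
  split_ifs <;> first | rfl | omega

/-- The conditions on the local dimensions. -/
structure AdmissibleDims {n : ℕ} (d : Fin n → ℕ) : Prop where
  parties : 3 ≤ n
  three_le : 3 ≤ dimAt d 0 - 1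
  le_one : dimAt d 0 - 1 ≤ dimAt d 1
  mono : ∀ i j, 1 ≤ i → i ≤ j → j < n → dimAt d i ≤ dimAt d j

variable {n : ℕ} {d : Fin n → ℕ}

theorem dimAt_coe (i : Fin n) : dimAt d i = d i := by
  simp [dimAt]

namespace AdmissibleDims

theorem three_le_blockDim (h : AdmissibleDims d) (k : ℕ) : 3 ≤ blockDim d k := by
  have := h.three_le
  have := h.le_one
  unfold blockDim
  split_ifs <;> omega

theorem blockDim_le (h : AdmissibleDims d) {k : ℕ} (hk0 : 0 < k) (hk : k < n) :
    blockDim d k ≤ dimAt d k := by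
  unfold blockDim
  split_ifs with h1
  · rw [h1]; exact h.le_one
  · exact h.mono 1 k le_rfl hk0 hk

theorem blockDim_le_left (d : Fin n → ℕ) (k : ℕ) : blockDim d k ≤ dimAt d (leftParty k) := by
  unfold blockDim leftParty
  split_ifs <;> omega

theorem three_le_dimAt (h : AdmissibleDims d) {i : ℕ} (hi : i < n) : 3 ≤ dimAt d i := by
  have := h.three_le
  rcases Nat.eq_zero_or_pos i with rfl | h0
  · omega
  · exact (this.trans h.le_one).trans (h.mono 1 i le_rfl h0 hi)

theorem fixedKet_lt (h : AdmissibleDims d) {k i : ℕ} (hi : i < n) :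
    fixedKet n (dimAt d 0) k i < dimAt d i := by
  have h3 := h.three_le_dimAt hi
  have := h.three_le
  unfold fixedKet
  split_ifs with h1 h2 h4 h5 <;> first | omega | (subst h5; omega)

end AdmissibleDims

theorem pairRight_eq_zero {a b : ℕ} (ha : 3 ≤ a) (hab : a ≤ b) (l : PairLabel a b) {u : ℕ}
    (hu : b ≤ u) : pairRight l u = 0 := by
  rcases l with i | i | i | i | _
  · rw [pairRight, ketMinus_apply, if_neg (by omega), if_neg (by omega)]; simp
  · rw [pairRight]; split_ifs <;> rw [ket, if_neg (by omega)]
  · rw [pairRight, ket, if_neg (by omega)]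
  · rw [pairRight, ketFourier_eq, Finset.sum_apply]
    refine Finset.sum_eq_zero fun t ht => ?_
    have := fourierIndex_lt ha hab (Finset.mem_range.1 ht)
    rw [Pi.smul_apply, ket, if_neg (by omega), smul_zero]
  · rw [pairRight, ketAll_apply, if_neg (by omega)]

/-- Needed for `G_1`, whose left factors live in a space one dimension smaller than that of `A_1`.
-/
theorem dotN_eq_of_support {a a' : ℕ} (h : a ≤ a') {f : ℕ → ℂ} (hf : ∀ u, a ≤ u → f u = 0)
    (g : ℕ → ℂ) : dotN a' f g = dotN a f g := by
  symm
  refine Finset.sum_subset (Finset.range_mono h) fun u _ hu => ?_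
  rw [hf u (by simpa using hu)]
  simp

/-- The vector of the party `A_{i+1}` in a state of the blocks. -/
noncomputable def partyFactor (d : Fin n → ℕ) (l : Label d) (i : ℕ) : ℕ → ℂ :=
  if i = leftParty (l.1 + 1) then pairLeft l.2
  else if i = l.1 + 1 then pairRight l.2
  else ket (fixedKet n (dimAt d 0) (l.1 + 1) i)

theorem blockState_eq (hn : 3 ≤ n) (l : Label d) :
    blockState d l = productState fun i (x : Fin (d i)) => partyFactor d l i x := by
  unfold blockState partyFactor
  congr
  ext i x
  rw [blockFactor_eq hn (by omega) (by omega)]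

theorem leftParty_lt (hn : 3 ≤ n) (k : ℕ) : leftParty k < n := by
  unfold leftParty
  split_ifs <;> omega

theorem leftParty_ne (k : ℕ) : k + 1 ≠ leftParty (k + 1) := by
  unfold leftParty
  split_ifs <;> omega

/-- States from different blocks are orthogonal at one of the parties. -/
theorem exists_dotN_partyFactor_eq_zero_of_lt (hd : AdmissibleDims d) {l l' : Label d}
    (h : l.1 < l'.1) : ∃ i < n, dotN (dimAt d i) (partyFactor d l i) (partyFactor d l' i) = 0 := by
  obtain ⟨κ, l⟩ := l
  obtain ⟨κ', l'⟩ := l'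
  have hn := hd.parties
  have h3 := hd.three_le
  have hlt : (κ : ℕ) < κ' := h
  have hκ' := κ'.2
  have key : ∀ i < n, i ≠ leftParty (κ + 1) → i ≠ leftParty (κ' + 1) → i ≠ κ + 1 → i ≠ κ' + 1 →
      fixedKet n (dimAt d 0) (κ + 1) i ≠ fixedKet n (dimAt d 0) (κ' + 1) i →
      ∃ i < n, dotN (dimAt d i) (partyFactor d ⟨κ, l⟩ i) (partyFactor d ⟨κ', l'⟩ i) = 0 := by
    intro i hi h1 h2 h4 h5 h6
    refine ⟨i, hi, ?_⟩
    simp only [partyFactor]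
    rw [if_neg h1, if_neg h2, if_neg h4, if_neg h5, dotN_ket (hd.fixedKet_lt hi), ket, if_neg h6]
  by_cases hlast : (κ' : ℕ) + 1 = n - 1
  · by_cases hfirst : (κ : ℕ) = 0
    -- First against last block: the left factors of `G_1` are supported below `d_1 - 1`, where the
    -- last block has its ket.
    · refine ⟨0, by omega, ?_⟩
      have hl : partyFactor d ⟨κ, l⟩ 0 = pairLeft l := if_pos (by simp [leftParty, hfirst])
      have hl' : partyFactor d ⟨κ', l'⟩ 0 = ket (dimAt d 0 - 1) := by
        unfold partyFactor
        rw [if_neg (by simp [leftParty]; omega), if_neg (by simp), fixedKet,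
          if_neg (by simp; omega), if_pos hlast, if_pos rfl]
      rw [hl, hl', ← dotN_star, dotN_ket (by omega),
        pairLeft_eq_zero (hd.three_le_blockDim _), star_zero]
      rw [blockDim, if_pos (by omega)]
    · refine key 0 (by omega) ?_ ?_ (by omega) (by omega) ?_ <;> simp only [leftParty, fixedKet] <;>
        split_ifs <;> omega
  · by_cases h0 : (κ : ℕ) = 0
    -- The marker `|1⟩` at `A_n` singles out `G_1` among the blocks other than the last. Below,
    -- `A_1` singles out `G_2`, and each later block is recognised by the marker at its own `A_k`.
    · refine key (n - 1) (by omega) ?_ ?_ (by omega) (by omega) ?_ <;>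
        simp only [leftParty, fixedKet] <;> split_ifs <;> omega
    · by_cases h1 : (κ : ℕ) = 1
      · refine key 0 (by omega) ?_ ?_ (by omega) (by omega) ?_ <;>
          simp only [leftParty, fixedKet] <;> split_ifs <;> omega
      · refine key κ (by omega) ?_ ?_ (by omega) (by omega) ?_ <;>
          simp only [leftParty, fixedKet] <;> split_ifs <;> omega

theorem exists_dotN_partyFactor_eq_zero (hd : AdmissibleDims d) {l l' : Label d} (h : l ≠ l') :
    ∃ i < n, dotN (dimAt d i) (partyFactor d l i) (partyFactor d l' i) = 0 := by
  rcases lt_trichotomy l.1 l'.1 with hlt | heq | hgt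
  · exact exists_dotN_partyFactor_eq_zero_of_lt hd hlt
  · obtain ⟨κ, l⟩ := l
    obtain ⟨κ', l'⟩ := l'
    obtain rfl : κ = κ' := heq
    have hn := hd.parties
    have ha := hd.three_le_blockDim (κ + 1)
    have hab := hd.blockDim_le (show 0 < (κ : ℕ) + 1 by omega) (by omega)
    rcases mul_eq_zero.1 (pair_orthogonal ha hab (l := l) (l' := l') (by simpa using h)) with h0 | h0
    · refine ⟨leftParty (κ + 1), leftParty_lt hn _, ?_⟩
      simp only [partyFactor, if_true]
      rw [dotN_eq_of_support (AdmissibleDims.blockDim_le_left d _) fun u hu => pairLeft_eq_zero ha l hu, h0]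
    · refine ⟨κ + 1, by omega, ?_⟩
      simp only [partyFactor, if_neg (leftParty_ne _), if_true]
      exact h0
  · obtain ⟨i, hi, h0⟩ := exists_dotN_partyFactor_eq_zero_of_lt hd hgt
    exact ⟨i, hi, by rw [← dotN_star, h0, star_zero]⟩

theorem blockState_mutuallyOrthogonal (hd : AdmissibleDims d) :
    MutuallyOrthogonal (blockState d) := by
  intro l l' h
  obtain ⟨i, hi, h0⟩ := exists_dotN_partyFactor_eq_zero hd h
  rw [blockState_eq hd.parties, blockState_eq hd.parties,
    productState_dotProduct (partyFactor d l ·) (partyFactor d l' ·)]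
  refine Finset.prod_eq_zero (Finset.mem_univ ⟨i, hi⟩) ?_
  rwa [← dimAt_coe (d := d) ⟨i, hi⟩]

theorem exists_partyFactor_ne_zero (hd : AdmissibleDims d) (l : Label d) {i : ℕ} (hi : i < n) :
    ∃ u < dimAt d i, partyFactor d l i u ≠ 0 := by
  have ha := hd.three_le_blockDim (l.1 + 1)
  have hab := hd.blockDim_le (show 0 < (l.1 : ℕ) + 1 by omega) (by omega)
  unfold partyFactor
  split_ifs with h1 h2
  · obtain ⟨u, hu, h⟩ := exists_pairLeft_ne_zero ha l.2
    exact ⟨u, h1 ▸ hu.trans_le (AdmissibleDims.blockDim_le_left d _), h⟩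
  · obtain ⟨u, hu, h⟩ := exists_pairRight_ne_zero ha hab l.2
    exact ⟨u, h2 ▸ hu, h⟩
  · exact ⟨_, hd.fixedKet_lt hi, by rw [ket, if_pos rfl]; exact one_ne_zero⟩

theorem blockState_ne_zero (hd : AdmissibleDims d) (l : Label d) : blockState d l ≠ 0 := by
  have : ∀ i : Fin n, ∃ u : Fin (d i), partyFactor d l i u ≠ 0 := fun i => by
    obtain ⟨u, hu, h⟩ := exists_partyFactor_ne_zero hd l i.2
    exact ⟨⟨u, by rwa [dimAt_coe] at hu⟩, h⟩
  choose u hu using this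
  intro h
  rw [blockState_eq hd.parties] at h
  exact Finset.prod_ne_zero_iff.2 (fun i _ => hu i) (congrFun h u)

open scoped ComplexOrder in
theorem blockState_injective (hd : AdmissibleDims d) : (blockState d).Injective := by
  intro l l' h
  by_contra hne
  have := blockState_mutuallyOrthogonal hd l l' hne
  -- Equal states under distinct labels would make a nonzero state orthogonal to itself.
  rw [← h] at this
  exact blockState_ne_zero hd l (dotProduct_star_self_eq_zero.1 this)

/-- The labels of the product states in `ℂ^a ⊗ ℂ^b`, as a disjoint union. -/
def pairLabelEquiv (a b : ℕ) :
    PairLabel a b ≃ (Fin (a - 1) ⊕ Fin (a - 1)) ⊕ (Fin (b - a) ⊕ Fin (b - a)) ⊕ Unit where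
  toFun
    | .first i => .inl (.inl i)
    | .second i => .inl (.inr i)
    | .third j => .inr (.inl (.inl j))
    | .fourth s => .inr (.inl (.inr s))
    | .last => .inr (.inr ())
  invFun
    | .inl (.inl i) => .first i
    | .inl (.inr i) => .second i
    | .inr (.inl (.inl j)) => .third j
    | .inr (.inl (.inr s)) => .fourth s
    | .inr (.inr ()) => .last
  left_inv l := by cases l <;> rfl
  right_inv l := by rcases l with (_ | _) | (_ | _) | _ <;> rfl

instance finite_pairLabel (a b : ℕ) : Finite (PairLabel a b) :=
  Finite.of_equiv _ (pairLabelEquiv a b).symm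

/-- In `2(a-1) + 2(b-a) + 1` the first dimension cancels, so a block's size depends only on its
second party. -/
theorem card_pairLabel {a b : ℕ} (ha : 3 ≤ a) (hab : a ≤ b) :
    Nat.card (PairLabel a b) = 2 * b - 1 := by
  rw [Nat.card_congr (pairLabelEquiv a b)]
  simp
  omega

theorem ncard_range_blockState (hd : AdmissibleDims d) :
    (Set.range (blockState d)).ncard =
      ∑ i ∈ Finset.univ.filter (fun i : Fin n => 1 ≤ (i : ℕ)), (2 * d i - 1) := by
  rw [← Set.image_univ, Set.ncard_image_of_injective _ (blockState_injective hd), Set.ncard_univ,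
    Nat.card_sigma]
  have h1 : ∀ κ : Fin (n - 1), Nat.card (PairLabel (blockDim d (κ + 1)) (dimAt d (κ + 1))) =
      2 * dimAt d (κ + 1) - 1 := fun κ =>
    card_pairLabel (hd.three_le_blockDim _) (hd.blockDim_le (by omega) (by omega))
  simp_rw [h1, ← dimAt_coe (d := d)]
  rw [Finset.sum_filter, ← Finset.sum_range fun i => 2 * dimAt d (i + 1) - 1,
    ← Finset.sum_range fun i => if 1 ≤ i then 2 * dimAt d i - 1 else 0]
  have shift : ∀ m, 1 ≤ m → ∀ g : ℕ → ℕ, ∑ i ∈ Finset.range (m - 1), g (i + 1) =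
      ∑ i ∈ Finset.range m, if 1 ≤ i then g i else 0 := by
    intro m hm g
    obtain ⟨m, rfl⟩ := Nat.exists_eq_add_of_le' hm
    rw [Finset.sum_range_succ']
    simp
  exact shift n (by have := hd.parties; omega) fun i => 2 * dimAt d i - 1

theorem blockState_genuinelyNonlocal (hd : AdmissibleDims d) :
    GenuinelyNonlocal (blockState d) := by
  intro S hS hSc
  have hn := hd.parties
  obtain ⟨κ, hκ⟩ : ∃ κ : Fin (n - 1), ¬ ((⟨leftParty (κ + 1), leftParty_lt hn _⟩ : Fin n) ∈ S ↔
      (⟨κ + 1, by omega⟩ : Fin n) ∈ S) := by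
    by_contra! hcon
    -- If no pair were cut, every party would be on the side of the centre `A_2`, and one side would
    -- be empty.
    have h1 : ∀ i : Fin n, i ∈ S ↔ (⟨1, by omega⟩ : Fin n) ∈ S := by
      rintro ⟨i, hi⟩
      rcases i with _ | _ | i
      · exact hcon ⟨0, by omega⟩
      · rfl
      · exact (hcon ⟨i + 1, by omega⟩).symm
    obtain ⟨i, hi⟩ := hS
    obtain ⟨j, hj⟩ := hSc
    exact Finset.mem_compl.1 hj ((h1 j).2 ((h1 i).1 hi))
  have ha := hd.three_le_blockDim (κ + 1)
  have hab := hd.blockDim_le (show 0 < (κ : ℕ) + 1 by omega) (by omega)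
  have : Nontrivial (PairLabel (blockDim d (κ + 1)) (dimAt d (κ + 1))) :=
    ⟨⟨.last, .first ⟨0, by omega⟩, by simp⟩⟩
  have he : Function.Injective fun l : PairLabel (blockDim d (κ + 1)) (dimAt d (κ + 1)) =>
      (⟨κ, l⟩ : Label d) := fun l l' h => by simpa using h
  have hp : blockDim d (κ + 1) ≤ d ⟨leftParty (κ + 1), leftParty_lt hn _⟩ := by
    rw [← dimAt_coe (d := d)]
    exact AdmissibleDims.blockDim_le_left d _
  have hq : dimAt d (κ + 1) ≤ d ⟨κ + 1, by omega⟩ := by rw [← dimAt_coe (d := d)]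
  have hc : ∀ i : Fin n, fixedKet n (dimAt d 0) (κ + 1) i < d i := fun i => by
    rw [← dimAt_coe (d := d)]
    exact hd.fixedKet_lt i.2
  have hX := fun (l : PairLabel (blockDim d (κ + 1)) (dimAt d (κ + 1))) u => pairLeft_eq_zero ha l (u := u)
  have hZ := fun (l : PairLabel (blockDim d (κ + 1)) (dimAt d (κ + 1))) u =>
    pairRight_eq_zero ha hab l (u := u)
  by_cases hpS : (⟨leftParty (κ + 1), leftParty_lt hn _⟩ : Fin n) ∈ S
  · refine not_distinguishable_of_locallyRigid hX hZ (exists_pairLeft_ne_zero ha)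
      (exists_pairRight_ne_zero ha hab) (locallyRigid_pairLeft ha hab)
      (locallyRigid_pairRight ha hab) he hp hq (fun i _ _ => hc i) (fun l => ?_) hpS
      (fun h => hκ (iff_of_true hpS h))
    rw [blockState_eq hn]
    simp only [partyFactor, Fin.ext_iff]
  -- The left party lies outside `S`, so the two factors exchange roles; rigidity holds for both.
  · refine not_distinguishable_of_locallyRigid hZ hX (exists_pairRight_ne_zero ha hab)
      (exists_pairLeft_ne_zero ha) (locallyRigid_pairRight ha hab)
      (locallyRigid_pairLeft ha hab) he hq hp (fun i _ _ => hc i) (fun l => ?_)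
      (by_contra fun h => hκ (iff_of_false hpS h)) hpS
    rw [blockState_eq hn]
    congr
    ext i x
    simp only [partyFactor, Fin.ext_iff]
    by_cases h1 : (i : ℕ) = leftParty (κ + 1)
    · have h2 : (i : ℕ) ≠ κ + 1 := fun h => leftParty_ne κ (h.symm.trans h1)
      rw [if_pos h1, if_neg h2, if_pos h1]
    · rw [if_neg h1, if_neg h1]

theorem applyLocal_diagonal (p : Fin n) (f : Fin (d p) → ℂ) (ψ : State d) (x : (i : Fin n) → Fin (d i)) :
    applyLocal p (Matrix.diagonal f) ψ x = f (x p) * ψ x := by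
  rw [applyLocal, Finset.sum_eq_single (x p)]
  · rw [Matrix.diagonal_apply_eq, Function.update_eq_self]
  · intro j _ hj
    rw [Matrix.diagonal_apply_ne _ hj.symm, zero_mul]
  · simp

/-- The first party is orthogonal to `|d₁ - 1⟩` exactly outside the last block. -/
theorem blockState_eq_zero (hd : AdmissibleDims d) (l : Label d) (x : (i : Fin n) → Fin (d i))
    (hx : ((x ⟨0, by have := hd.parties; omega⟩ : ℕ) = dimAt d 0 - 1 ↔ ¬ (l.1 : ℕ) + 1 = n - 1)) :
    blockState d l x = 0 := by
  have hn := hd.parties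
  have h3 := hd.three_le
  rw [blockState_eq hn]
  refine Finset.prod_eq_zero (Finset.mem_univ ⟨0, by omega⟩) ?_
  simp only [partyFactor]
  by_cases h1 : (l.1 : ℕ) = 0
  · rw [if_pos (by simp [leftParty, h1]), pairLeft_eq_zero (hd.three_le_blockDim _)]
    rw [blockDim, if_pos (by omega)]
    exact (hx.2 (by omega)).ge
  · rw [if_neg (by simp [leftParty, h1]), if_neg (by omega), ket, if_neg]
    by_cases hl : (l.1 : ℕ) + 1 = n - 1
    · simp only [fixedKet]
      rw [if_neg (by omega), if_pos hl, if_pos trivial]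
      exact fun h => hx.1 h hl
    · rw [hx.2 hl]
      simp only [fixedKet]
      split_ifs <;> omega

theorem blockState_locallyReducible (hd : AdmissibleDims d) : LocallyReducible (blockState d) := by
  have hn := hd.parties
  have h3 := hd.three_le
  have h0 : dimAt d 0 = d ⟨0, by omega⟩ := dimAt_coe (d := d) ⟨0, by omega⟩
  -- Outcome 1 projects onto `|d_1-1⟩`, outcome 0 onto its complement.
  let f : Fin 2 → Fin (d ⟨0, by omega⟩) → ℂ :=
    fun k x => if ((x : ℕ) = dimAt d 0 - 1 ↔ k = 1) then 1 else 0
  have happly : ∀ k l, applyLocal ⟨0, by omega⟩ (Matrix.diagonal (f k)) (blockState d l) =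
      if ((l.1 : ℕ) + 1 = n - 1 ↔ k = 1) then blockState d l else 0 := by
    intro k l
    ext x
    rw [applyLocal_diagonal]
    by_cases hx : (x ⟨0, by omega⟩ : ℕ) = dimAt d 0 - 1 ↔ (l.1 : ℕ) + 1 = n - 1
    · by_cases hk : (l.1 : ℕ) + 1 = n - 1 ↔ k = 1
      · rw [if_pos hk]
        simp only [f]
        rw [if_pos (hx.trans hk), one_mul]
      · rw [if_neg hk]
        simp only [f]
        rw [if_neg (fun h => hk (hx.symm.trans h)), zero_mul]
        rfl
    · have hz := blockState_eq_zero hd l x (by tauto)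
      rw [hz, mul_zero]
      split_ifs
      exacts [hz.symm, rfl]
  refine ⟨⟨0, by omega⟩, 2, fun k => Matrix.diagonal (f k), ?_, ?_, ?_, ?_⟩
  · simp only [Matrix.diagonal_conjTranspose, Matrix.diagonal_mul_diagonal, Fin.sum_univ_two,
      Matrix.diagonal_add, ← Matrix.diagonal_one]
    congr 1
    ext x
    by_cases hx : (x : ℕ) = dimAt d 0 - 1 <;> simp [f, hx]
  · intro k l l' h
    simp only [happly]
    have := blockState_mutuallyOrthogonal hd l l' h
    split_ifs <;> simp [this]
  · refine ⟨1, fun c hc => ?_⟩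
    -- The projector has diagonal entry 0 at `|0⟩` and 1 at `|d_1-1⟩`, so it is not scalar.
    have h1 := congrFun (congrFun hc ⟨0, by omega⟩) ⟨0, by omega⟩
    have h2 := congrFun (congrFun hc ⟨dimAt d 0 - 1, by omega⟩) ⟨dimAt d 0 - 1, by omega⟩
    simp [f, Matrix.diagonal_conjTranspose, show ¬ (0 = dimAt d 0 - 1) by omega] at h1 h2
    rw [← h1] at h2
    simp at h2
  · intro k _
    -- Outcome 1 eliminates `G_1` and outcome 0 eliminates `G_{n-1}`; these blocks differ because `3
    -- ≤ n`.
    by_cases hk : k = 1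
    · refine ⟨⟨⟨0, by omega⟩, .last⟩, ?_⟩
      rw [happly, if_neg]
      simp [hk]
      omega
    · refine ⟨⟨⟨n - 2, by omega⟩, .last⟩, ?_⟩
      rw [happly, if_neg]
      simp [hk]
      omega

end Blocks

end QNonlocal

theorem theorem2 (n : ℕ) (hn : 3 ≤ n) (d : Fin n → ℕ)
    (h₁ : 3 ≤ d ⟨0, by omega⟩ - 1)
    (h₂ : d ⟨0, by omega⟩ - 1 ≤ d ⟨1, by omega⟩)
    (hmono : ∀ i j : Fin n, 1 ≤ (i : ℕ) → i ≤ j → d i ≤ d j) :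
    (Set.range (QNonlocal.blockState d)).ncard =
        ∑ i ∈ Finset.univ.filter (fun i : Fin n => 1 ≤ (i : ℕ)), (2 * d i - 1) ∧
      (∀ l, QNonlocal.blockState d l ≠ 0) ∧
      QNonlocal.MutuallyOrthogonal (QNonlocal.blockState d) ∧
      (∀ l, ∃ v : (i : Fin n) → Fin (d i) → ℂ,
        QNonlocal.blockState d l = QNonlocal.productState v) ∧
      QNonlocal.GenuinelyNonlocalTypeI (QNonlocal.blockState d) := by
  have hd : QNonlocal.AdmissibleDims d := by
    have h0 := QNonlocal.dimAt_coe (d := d) ⟨0, by omega⟩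
    have h1 := QNonlocal.dimAt_coe (d := d) ⟨1, by omega⟩
    refine ⟨hn, h0 ▸ h₁, ?_, fun i j hi hij hj => ?_⟩
    · rw [h0, h1]
      exact h₂
    · have hi' := QNonlocal.dimAt_coe (d := d) ⟨i, by omega⟩
      have hj' := QNonlocal.dimAt_coe (d := d) ⟨j, hj⟩
      rw [hi', hj']
      exact hmono _ _ hi hij
  exact ⟨QNonlocal.ncard_range_blockState hd, QNonlocal.blockState_ne_zero hd,
    QNonlocal.blockState_mutuallyOrthogonal hd, fun l => ⟨_, rfl⟩,
    QNonlocal.blockState_genuinelyNonlocal hd, QNonlocal.blockState_locallyReducible hd⟩
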